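/- For positive integers $N,S$ and a map $G_{N,S}:\{1,\dots,S\}\to\{-1,+1\}^N$, written $G_{N,S}(s)=(e_1(s),\dots,e_N(s))$, the cross-correlation measure of order $k$ is $$\Phi_k(G_{N,S})=\max\left|\sum_{n=1}^{M}e_{n+d_1}(s_1)\cdots e_{n+d_k}(s_k)\right|,$$ where the maximum is over all integers $M,d_1,\dots,d_k$ and $1\le s_1,\dots,s_k\le S$ such that $0\le d_1\le d_2\le\dots\le d_k<M+d_k\le N$ and $d_i\ne d_j$ whenever $i\neq j$ and $s_i=s_j$ (a maximum over the empty set, possible only for small $N$, is taken to be $0$). Theorem. Let $S$ be a positive integer and let $e_n(s)$ ($n\ge 1$, $1\le s\le S$) be independent random variables, each uniformly distributed on $\{-1,+1\}$, i.e. for all $N$ every prescription of the values $e_n(s)$, $1\le n\le N$, $1\le s\le S$, has probability $2^{-NS}$. Put $G_{N,S}(s)=(e_1(s),\dots,e_N(s))$ for $1\le s\le S$. Then for every fixed integer $k\ge 2$, $$\frac{\Phi_k(G_{N,S})}{\sqrt{2N\log\binom{N}{k-1}}}\longrightarrow 1\quad\text{almost surely as }N\to\infty,$$ where $\log$ is the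 natural logarithm. -/

import Mathlib

open Filter Topology MeasureTheory

/-- The `n`-th entry of a finite sign sequence of length `N` (positions `0, …, N - 1`), as an
integer. Positions outside the sequence are read as `0`; the admissible tuples below never reach
such a position. -/
def signEntry {N : ℕ} (w : Fin N → ℤˣ) (n : ℕ) : ℤ :=
  if h : n < N then ((w ⟨n, h⟩ : ℤˣ) : ℤ) else 0

/-- The tuples `(M, d₁, …, d_k, s₁, …, s_k)` over which the cross-correlation measure of order `k`
takes its maximum: `0 ≤ d₁ ≤ ⋯ ≤ d_k < M + d_k ≤ N`, and `d_i ≠ d_j` whenever `s_i = s_j` for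
distinct `i`, `j`. -/
def IsAdmissible (N S k M : ℕ) (d : Fin k → ℕ) (s : Fin k → Fin S) : Prop :=
  1 ≤ M ∧ Monotone d ∧ (∀ i, M + d i ≤ N) ∧ ∀ i j, i ≠ j → s i = s j → d i ≠ d j

/-- The sum `∑_{n=1}^{M} e_{n+d₁}(s₁) ⋯ e_{n+d_k}(s_k)` (positions counted from `0`). -/
def correlationSum {N S k : ℕ} (G : Fin S → Fin N → ℤˣ) (M : ℕ) (d : Fin k → ℕ)
    (s : Fin k → Fin S) : ℤ :=
  ∑ n ∈ Finset.range M, ∏ i, signEntry (G (s i)) (n + d i)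

open Classical in
/-- The cross-correlation measure `Φ_k(G)` of order `k` of a family `G` of `S` sign sequences of
length `N`: the maximum of the absolute values of the correlation sums over all admissible tuples
(the maximum over the empty set being `0`). The bounds `M ≤ N` and `d i < N` built into the index
types follow from admissibility. -/
noncomputable def crossCorrelation {N S : ℕ} (k : ℕ) (G : Fin S → Fin N → ℤˣ) : ℕ :=
  (Finset.univ.filter
      (fun t : Fin (N + 1) × (Fin k → Fin N) × (Fin k → Fin S) =>
        IsAdmissible N S k t.1 (fun i => (t.2.1 i : ℕ)) t.2.2)).sup
    (fun t => (correlationSum G t.1 (fun i => (t.2.1 i : ℕ)) t.2.2).natAbs)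

/-- Every set of signs is measurable. -/
instance instDiscreteMeasurableSpaceSign : DiscreteMeasurableSpace ℤˣ where
  forall_measurableSet t :=
    ⟨Units.val '' t, MeasurableSet.of_discrete, Set.preimage_image_eq t Units.val_injective⟩

/-- The law of an infinite random family of `S` independent uniform sign sequences: the product,
over all pairs `(s, n)`, of the uniform distribution on `{-1, +1}`. -/
noncomputable def randomFamily (S : ℕ) : Measure (Fin S × ℕ → ℤˣ) :=
  Measure.infinitePi fun _ => (PMF.uniformOfFintype ℤˣ).toMeasure

/-- The truncation of an infinite family to its first `N` entries. -/
def truncation {S : ℕ} (G : Fin S × ℕ → ℤˣ) (N : ℕ) : Fin S → Fin N → ℤˣ :=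
  fun s n => G (s, n)

/-- Each prescription of the first `N` entries of all `S` sequences has probability `2^(-N S)`. -/
theorem randomFamily_cylinder (S N : ℕ) (c : Fin S → Fin N → ℤˣ) :
    randomFamily S {G | truncation G N = c} = 2⁻¹ ^ (N * S) := by
  classical
  have hset : {G : Fin S × ℕ → ℤˣ | truncation G N = c} =
      Set.pi ((Finset.univ ×ˢ Finset.range N : Finset (Fin S × ℕ)) : Set (Fin S × ℕ))
        (fun p => {x | ∀ h : p.2 < N, x = c p.1 ⟨p.2, h⟩}) := by
    ext G
    simp only [Set.mem_ofPred_eq, Set.mem_pi, Finset.mem_coe, Finset.mem_product, Finset.mem_univ,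
      Finset.mem_range, true_and, funext_iff, truncation]
    exact ⟨fun h p _ hp => h p.1 ⟨p.2, hp⟩, fun h s n => h (s, n) n.2 n.2⟩
  rw [hset, randomFamily, Measure.infinitePi_pi _ (fun _ _ => MeasurableSet.of_discrete),
    Finset.prod_congr rfl (g := fun _ => (2 : ENNReal)⁻¹)]
  · simp [mul_comm]
  · rintro ⟨s, n⟩ hp
    have hn : n < N := by simpa using hp
    have : {x : ℤˣ | ∀ h : n < N, x = c s ⟨n, h⟩} = {c s ⟨n, hn⟩} := by
      ext x; simp [hn]
    rw [this, PMF.toMeasure_apply_singleton _ _ (MeasurableSet.of_discrete)]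
    simp

/-!
Write `k = m + 1`. The binomial coefficient satisfies `log (N.choose m) ~ m log N`, so the claim is
that the cross-correlation measure is asymptotic to `scale m N = √(2 N m log N)`. By
`randomFamily_truncation_le`, only finite averages over the families of length `N` are needed.

*Walks.* A correlation sum adds up products of signs over the translates of a nonempty set of
positions. The last position of each translate is met by no earlier translate, so flipping the
sign there shows that the sum is distributed as a simple random walk: `expect_exp_walk` computes
its moment generating function, and Hoeffding's inequality `prob_abs_walk_le` follows.

*Upper bound.* Relative to its first shift a tuple is one of at most `N ^ m * S ^ (m + 1)`
sets of positions. Up to corrections on short intervals, the interval of summation can be taken from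
a bounded number of intervals, so the union bound `prob_lt_crossCorrelation_le` leaves a factor
`N ^ m * N ^ (-(1 + ε) ^ 2 * m)`, a negative power of `N`.

*Lower bound.* Fix one sequence and a last shift `K`, a small proportion of `N`, and take the
walks `C_A` along `A ∪ {K}` for the `m`-element subsets `A` of `{0, …, K - 1}`. The second moment
method is applied to the number of large `C_A`, counted with the weights `exp (t * C_A)` for `t`
slightly below the critical value, normalized and restricted to `C_A ≈ M * t` (`tiltedWeight`).
Given the earlier signs, the `n`-th increments of `C_A` and `C_B` are `e P` and `e Q` with a fresh
sign `e`; hence `exp (t * (C_A + C_B))` is an exponential martingale times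
`∏ cosh (t * (P + Q))`, which is at most `(cosh t) ^ (2 * M) * exp (τ ^ 2 * ∑ P * Q)` for
`τ = tanh t ≤ t`. The overlap `∑ P * Q` is the walk along the symmetric difference of `A` and `B`,
thus at most `N ^ (3 / 4)` except with tiny probability, and `t ^ 2 * N ^ (3 / 4)` tends to `0`.
So distinct weights are nearly uncorrelated (`expect_tiltedWeight_mul_le`), and
`prob_crossCorrelation_lt_le` bounds the lower tail, again by a negative power of `N`.

*Almost sure convergence.* The tail bounds are summable along `N = j ^ r` for large `r`. By
Borel–Cantelli the limit holds along this sequence, and it extends to all `N` because both the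
cross-correlation measure (`monotone_crossCorrelation`) and its scale are monotone in `N`, while
consecutive terms of the scale along `j ^ r` have ratio tending to `1`.
-/

open scoped BigOperators

namespace SignFamily

variable {N S : ℕ}

/-! ### Flipping one sign -/

/-- The sign at position `p.2` of the sequence `p.1`, as a real number; it is `0` when
`p.2` lies beyond the end of the sequence. -/
noncomputable def sgn (G : Fin S → Fin N → ℤˣ) (p : Fin S × ℕ) : ℝ := (signEntry (G p.1) p.2 : ℝ)

/-- The family obtained by changing the sign at position `p.2` of the sequence `p.1`. -/
def flip (p : Fin S × ℕ) (G : Fin S → Fin N → ℤˣ) : Fin S → Fin N → ℤˣ :=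
  fun s n => if (s, (n : ℕ)) = p then -G s n else G s n

lemma flip_flip (p : Fin S × ℕ) (G : Fin S → Fin N → ℤˣ) : flip p (flip p G) = G := by
  funext s n
  by_cases h : (s, (n : ℕ)) = p <;> simp [flip, h]

lemma sgn_flip (p q : Fin S × ℕ) (G : Fin S → Fin N → ℤˣ) :
    sgn (flip p G) q = if q = p then -sgn G q else sgn G q := by
  obtain ⟨s, n⟩ := q
  unfold sgn signEntry flip
  by_cases h : n < N <;> by_cases h' : (s, n) = p <;> simp [h, h']

lemma sgn_flip_self (p : Fin S × ℕ) (G : Fin S → Fin N → ℤˣ) :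
    sgn (flip p G) p = -sgn G p := by simp [sgn_flip]

lemma sgn_flip_of_ne {p q : Fin S × ℕ} (h : q ≠ p) (G : Fin S → Fin N → ℤˣ) :
    sgn (flip p G) q = sgn G q := by simp [sgn_flip, h]

lemma sgn_eq_or (G : Fin S → Fin N → ℤˣ) {p : Fin S × ℕ} (hp : p.2 < N) :
    sgn G p = 1 ∨ sgn G p = -1 := by
  unfold sgn signEntry
  rcases Int.units_eq_one_or (G p.1 ⟨p.2, hp⟩) with h | h <;> simp [hp, h]

lemma expect_flip (p : Fin S × ℕ) (f : (Fin S → Fin N → ℤˣ) → ℝ) :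
    𝔼 G, f (flip p G) = 𝔼 G, f G :=
  Fintype.expect_equiv ⟨flip p, flip p, flip_flip p, flip_flip p⟩ _ _ fun _ => rfl

/-- A product formula that replaces independence. If the `n`-th factor averages to `c`
under flipping the sign `p n`, and the earlier factors do not see this sign, then the product of
`L` factors has expectation `c ^ L`. -/
lemma expect_prod_of_flip (p : ℕ → Fin S × ℕ) (f : ℕ → (Fin S → Fin N → ℤˣ) → ℝ) (c : ℝ) (L : ℕ)
    (h₁ : ∀ n < L, ∀ m < n, ∀ G, f m (flip (p n) G) = f m G)
    (h₂ : ∀ n < L, ∀ G, f n G + f n (flip (p n) G) = 2 * c) :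
    𝔼 G, ∏ n ∈ Finset.range L, f n G = c ^ L := by
  induction L with
  | zero => simp
  | succ L ih =>
    have hflip := expect_flip (p L) fun G => ∏ n ∈ Finset.range (L + 1), f n G
    have hsum : (𝔼 G, ∏ n ∈ Finset.range (L + 1), f n G) +
        𝔼 G, ∏ n ∈ Finset.range (L + 1), f n (flip (p L) G) =
        𝔼 G, (∏ n ∈ Finset.range L, f n G) * (2 * c) := by
      rw [← Finset.expect_add_distrib]
      refine Finset.expect_congr rfl fun G _ => ?_
      rw [Finset.prod_range_succ, Finset.prod_range_succ,
        Finset.prod_congr rfl fun n hn => h₁ L (Nat.lt_succ_self L) n (Finset.mem_range.1 hn) G,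
        ← mul_add, h₂ L (Nat.lt_succ_self L)]
    rw [hflip, ← Finset.expect_mul, ih (fun n hn => h₁ n (by omega)) fun n hn => h₂ n (by omega)]
      at hsum
    rw [pow_succ]
    linarith

/-! ### Walks along translates of a set of positions -/

/-- The product of the signs in the translate by `n` of the set `T` of positions. -/
noncomputable def monomial (G : Fin S → Fin N → ℤˣ) (T : Finset (Fin S × ℕ)) (n : ℕ) : ℝ :=
  ∏ p ∈ T, sgn G (p.1, n + p.2)

/-- The sum over `a ≤ n < b` of the products of the signs in the translates by `n` of `T`. -/
noncomputable def walk (G : Fin S → Fin N → ℤˣ) (T : Finset (Fin S × ℕ)) (a b : ℕ) : ℝ :=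
  ∑ n ∈ Finset.Ico a b, monomial G T n

lemma monomial_eq_or (G : Fin S → Fin N → ℤˣ) {T : Finset (Fin S × ℕ)} {n : ℕ}
    (hT : ∀ p ∈ T, n + p.2 < N) : monomial G T n = 1 ∨ monomial G T n = -1 := by
  rw [← sq_eq_one_iff, monomial, ← Finset.prod_pow]
  exact Finset.prod_eq_one fun p hp => sq_eq_one_iff.2 (sgn_eq_or G (hT p hp))

lemma monomial_flip_of_forall_ne {T : Finset (Fin S × ℕ)} {n : ℕ} {q : Fin S × ℕ}
    (h : ∀ p ∈ T, n + p.2 ≠ q.2) (G : Fin S → Fin N → ℤˣ) :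
    monomial (flip q G) T n = monomial G T n :=
  Finset.prod_congr rfl fun p hp => sgn_flip_of_ne (fun e => h p hp (by rw [← e])) G

lemma monomial_flip_mem {T : Finset (Fin S × ℕ)} {q : Fin S × ℕ} (hq : q ∈ T) (n : ℕ)
    (G : Fin S → Fin N → ℤˣ) :
    monomial (flip (q.1, n + q.2) G) T n = -monomial G T n := by
  unfold monomial
  rw [← Finset.mul_prod_erase T _ hq, ← Finset.mul_prod_erase T _ hq, sgn_flip_self, neg_mul]
  congr 2
  refine Finset.prod_congr rfl fun p hp => sgn_flip_of_ne (fun e => ?_) G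
  simp only [Prod.mk.injEq, Nat.add_left_cancel_iff] at e
  exact Finset.ne_of_mem_erase hp (Prod.ext e.1 e.2)

lemma exp_add_exp_neg (x : ℝ) : Real.exp x + Real.exp (-x) = 2 * Real.cosh x := by
  rw [Real.cosh_eq]; ring

/-- A walk along the translates of a nonempty set of positions has the moment generating function
of a simple random walk: each translate contains a position, its last one, that no earlier
translate meets. -/
lemma expect_exp_walk {T : Finset (Fin S × ℕ)} (hne : T.Nonempty) {a b : ℕ}
    (hT : ∀ p ∈ T, b + p.2 ≤ N) (t : ℝ) :
    𝔼 G : Fin S → Fin N → ℤˣ, Real.exp (t * walk G T a b) = Real.cosh t ^ (b - a) := by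
  obtain ⟨q, hq, hmax⟩ := T.exists_max_image Prod.snd hne
  rw [← expect_prod_of_flip (N := N) (fun n => (q.1, a + n + q.2))
    (fun n G => Real.exp (t * monomial G T (a + n)))]
  · refine Finset.expect_congr rfl fun G _ => ?_
    rw [walk, Finset.sum_Ico_eq_sum_range, Finset.mul_sum, Real.exp_sum]
  · intro n _ m hm G
    rw [monomial_flip_of_forall_ne]
    intro p hp
    have := hmax p hp
    simp only
    omega
  · intro n hn G
    rw [monomial_flip_mem hq, mul_neg, exp_add_exp_neg]
    rcases monomial_eq_or G (T := T) (n := a + n) fun p hp => by have := hT p hp; omega with h | h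
    · rw [h, mul_one]
    · rw [h, mul_neg_one, Real.cosh_neg]

lemma monomial_mul_monomial (G : Fin S → Fin N → ℤˣ) {A B : Finset (Fin S × ℕ)} {n : ℕ}
    (hA : ∀ p ∈ A, n + p.2 < N) :
    monomial G A n * monomial G B n = monomial G (symmDiff A B) n := by
  have hI : monomial G (A ∩ B) n * monomial G (A ∩ B) n = 1 :=
    mul_self_eq_one_iff.2 (monomial_eq_or G fun p hp => hA p (Finset.mem_of_mem_inter_left hp))
  have h₁ : monomial G A n = monomial G (A \ B) n * monomial G (A ∩ B) n := by
    unfold monomial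
    rw [← Finset.prod_union (Finset.disjoint_sdiff_inter A B), Finset.sdiff_union_inter]
  have h₂ : monomial G B n = monomial G (B \ A) n * monomial G (A ∩ B) n := by
    unfold monomial
    rw [Finset.inter_comm, ← Finset.prod_union (Finset.disjoint_sdiff_inter B A),
      Finset.sdiff_union_inter]
  have h₃ : monomial G (symmDiff A B) n = monomial G (A \ B) n * monomial G (B \ A) n := by
    unfold monomial
    rw [symmDiff_def, Finset.sup_eq_union, Finset.prod_union]
    exact disjoint_sdiff_sdiff
  rw [h₁, h₂, h₃, mul_mul_mul_comm, hI, mul_one]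

lemma monomial_insert (G : Fin S → Fin N → ℤˣ) {A : Finset (Fin S × ℕ)} {q : Fin S × ℕ}
    (hq : q ∉ A) (n : ℕ) :
    monomial G (insert q A) n = sgn G (q.1, n + q.2) * monomial G A n :=
  Finset.prod_insert hq

/-- The exponential martingale of two walks whose translates end in the same position `q`: given
the earlier signs, the increment `e (P + Q)` takes the values `±(P + Q)` with equal
probability. -/
lemma expect_prod_exp_div_cosh {A B : Finset (Fin S × ℕ)} {q : Fin S × ℕ} {L : ℕ}
    (hA : ∀ p ∈ A, p.2 < q.2) (hB : ∀ p ∈ B, p.2 < q.2) (hL : L + q.2 ≤ N) (t : ℝ) :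
    𝔼 G : Fin S → Fin N → ℤˣ, ∏ n ∈ Finset.range L,
      Real.exp (t * (sgn G (q.1, n + q.2) * (monomial G A n + monomial G B n))) /
        Real.cosh (t * (monomial G A n + monomial G B n)) = 1 := by
  have key := expect_prod_of_flip (N := N) (fun n => (q.1, n + q.2)) (fun n G =>
      Real.exp (t * (sgn G (q.1, n + q.2) * (monomial G A n + monomial G B n))) /
        Real.cosh (t * (monomial G A n + monomial G B n))) 1 L ?_ ?_
  · simpa using key
  · intro n _ m hm G
    rw [monomial_flip_of_forall_ne fun p hp => ?_, monomial_flip_of_forall_ne fun p hp => ?_,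
      sgn_flip_of_ne]
    · simp only [ne_eq, Prod.mk.injEq, true_and]; omega
    · have := hB p hp; simp only; omega
    · have := hA p hp; simp only; omega
  · intro n hn G
    rw [monomial_flip_of_forall_ne fun p hp => ?_, monomial_flip_of_forall_ne fun p hp => ?_,
      sgn_flip_self, ← add_div, div_eq_iff (Real.cosh_pos _).ne', mul_one, ← exp_add_exp_neg]
    · rcases sgn_eq_or G (p := (q.1, n + q.2)) (by simp only; omega) with h | h
      · rw [h, one_mul, neg_one_mul, mul_neg]
      · rw [h, neg_neg, one_mul, neg_one_mul, mul_neg, add_comm]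
    · have := hB p hp; simp only; omega
    · have := hA p hp; simp only; omega

lemma sinh_le_mul_cosh {t : ℝ} (ht : 0 ≤ t) : Real.sinh t ≤ t * Real.cosh t := by
  have hmono : MonotoneOn (fun x : ℝ => x * Real.cosh x - Real.sinh x) (Set.Ici 0) := by
    refine monotoneOn_of_deriv_nonneg (convex_Ici 0) (by fun_prop) (by fun_prop) fun x hx => ?_
    rw [interior_Ici] at hx
    have : HasDerivAt (fun x : ℝ => x * Real.cosh x - Real.sinh x)
        (1 * Real.cosh x + x * Real.sinh x - Real.cosh x) x :=
      ((hasDerivAt_id x).mul (Real.hasDerivAt_cosh x)).sub (Real.hasDerivAt_sinh x)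
    rw [this.deriv]
    have := mul_nonneg hx.le (Real.sinh_nonneg_iff.2 hx.le)
    linarith
  have := hmono Set.self_mem_Ici (Set.mem_Ici.2 ht) ht
  simp only [zero_mul, Real.sinh_zero, sub_zero] at this
  linarith

lemma cosh_mul_add_le {t x y : ℝ} (hx : x = 1 ∨ x = -1)
    (hy : y = 1 ∨ y = -1) :
    Real.cosh (t * (x + y)) ≤
      Real.cosh t ^ 2 * Real.exp ((Real.sinh t / Real.cosh t) ^ 2 * (x * y)) := by
  have hc := Real.cosh_pos t
  have h₁ : Real.cosh (t * (x + y)) =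
      Real.cosh t ^ 2 * ((Real.sinh t / Real.cosh t) ^ 2 * (x * y) + 1) := by
    have h₂ := Real.cosh_sq t
    have h₃ := Real.cosh_two_mul t
    have h₄ : Real.cosh (t * (-1 + -1)) = Real.cosh (2 * t) := by
      rw [← Real.cosh_neg]; congr 1; ring
    have h₅ : Real.cosh (t * (1 + 1)) = Real.cosh (2 * t) := by congr 1; ring
    rcases hx with rfl | rfl <;> rcases hy with rfl | rfl <;> (try rw [h₄]) <;> (try rw [h₅]) <;>
      field_simp <;> (try simp) <;> linarith
  rw [h₁]
  exact mul_le_mul_of_nonneg_left (Real.add_one_le_exp _) (by positivity)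

/-- Where the walk along the symmetric difference of `A` and `B` stays below `η`, the joint
exponential moment of the walks along `A ∪ {q}` and `B ∪ {q}` is nearly that of independent
walks. -/
lemma exp_walk_add_walk_le {A B : Finset (Fin S × ℕ)} {q : Fin S × ℕ} {L : ℕ}
    (hA : ∀ p ∈ A, p.2 < q.2) (hB : ∀ p ∈ B, p.2 < q.2) (hL : L + q.2 ≤ N) {t : ℝ} (ht : 0 ≤ t)
    {η : ℝ} (hη : 0 ≤ η) (G : Fin S → Fin N → ℤˣ) (hG : walk G (symmDiff A B) 0 L ≤ η) :
    Real.exp (t * (walk G (insert q A) 0 L + walk G (insert q B) 0 L)) ≤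
      (∏ n ∈ Finset.range L,
        Real.exp (t * (sgn G (q.1, n + q.2) * (monomial G A n + monomial G B n))) /
          Real.cosh (t * (monomial G A n + monomial G B n))) *
        ((Real.cosh t ^ L) ^ 2 * Real.exp (t ^ 2 * η)) := by
  set τ := (Real.sinh t / Real.cosh t) ^ 2 with hτ
  have hτt : τ ≤ t ^ 2 := by
    refine pow_le_pow_left₀ (div_nonneg (Real.sinh_nonneg_iff.2 ht) (Real.cosh_pos t).le) ?_ 2
    rw [div_le_iff₀ (Real.cosh_pos t)]
    exact sinh_le_mul_cosh ht
  have hqA : q ∉ A := fun h => (hA q h).ne rfl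
  have hqB : q ∉ B := fun h => (hB q h).ne rfl
  have hLHS : Real.exp (t * (walk G (insert q A) 0 L + walk G (insert q B) 0 L)) =
      ∏ n ∈ Finset.range L,
        Real.exp (t * (sgn G (q.1, n + q.2) * (monomial G A n + monomial G B n))) := by
    rw [← Real.exp_sum, ← Finset.mul_sum]
    simp only [walk, monomial_insert G hqA, monomial_insert G hqB, mul_add,
      Finset.sum_add_distrib, Finset.range_eq_Ico]
  have hcosh : ∏ n ∈ Finset.range L, Real.cosh (t * (monomial G A n + monomial G B n)) ≤
      (Real.cosh t ^ L) ^ 2 * Real.exp (t ^ 2 * η) := by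
    calc _ ≤ ∏ n ∈ Finset.range L,
          (Real.cosh t ^ 2 * Real.exp (τ * monomial G (symmDiff A B) n)) := by
          refine Finset.prod_le_prod (fun n _ => (Real.cosh_pos _).le) fun n hn => ?_
          have hn := Finset.mem_range.1 hn
          rw [← monomial_mul_monomial G fun p hp => by have := hA p hp; omega]
          exact cosh_mul_add_le (monomial_eq_or G fun p hp => by have := hA p hp; omega)
            (monomial_eq_or G fun p hp => by have := hB p hp; omega)
      _ = (Real.cosh t ^ L) ^ 2 * Real.exp (τ * walk G (symmDiff A B) 0 L) := by
          rw [Finset.prod_mul_distrib, Finset.prod_const, Finset.card_range, ← Real.exp_sum,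
            ← Finset.mul_sum, walk, Finset.range_eq_Ico]
          ring
      _ ≤ _ := by
          refine mul_le_mul_of_nonneg_left (Real.exp_le_exp.2 ?_) (by positivity)
          exact (mul_le_mul_of_nonneg_left hG (by positivity)).trans
            (mul_le_mul_of_nonneg_right hτt hη)
  rw [hLHS, Finset.prod_div_distrib, div_mul_eq_mul_div, le_div_iff₀
    (Finset.prod_pos fun n _ => Real.cosh_pos _)]
  exact mul_le_mul_of_nonneg_left hcosh (Finset.prod_nonneg fun n _ => (Real.exp_pos _).le)

/-! ### Probabilities on the finite space -/

open Classical in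
/-- The probability of an event under the uniform distribution on families of `S` sign sequences
of length `N`. -/
noncomputable def prob (E : (Fin S → Fin N → ℤˣ) → Prop) : ℝ := 𝔼 G, if E G then (1 : ℝ) else 0

lemma prob_le_expect {E : (Fin S → Fin N → ℤˣ) → Prop} {f : (Fin S → Fin N → ℤˣ) → ℝ}
    (hf : ∀ G, 0 ≤ f G) (h : ∀ G, E G → 1 ≤ f G) : prob E ≤ 𝔼 G, f G := by
  refine Finset.expect_le_expect fun G _ => ?_
  split_ifs with hG
  exacts [h G hG, hf G]

lemma prob_mono {E F : (Fin S → Fin N → ℤˣ) → Prop} (h : ∀ G, E G → F G) : prob E ≤ prob F := by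
  refine prob_le_expect (fun G => ?_) fun G hG => ?_
  · split_ifs <;> simp
  · simp [h G hG]

lemma prob_exists_le {ι : Type*} (s : Finset ι) (E : ι → (Fin S → Fin N → ℤˣ) → Prop) (x : ℝ)
    (h : ∀ i ∈ s, prob (E i) ≤ x) : prob (fun G => ∃ i ∈ s, E i G) ≤ s.card * x := by
  classical
  calc prob (fun G => ∃ i ∈ s, E i G) ≤ 𝔼 G, ∑ i ∈ s, if E i G then (1 : ℝ) else 0 := by
        refine prob_le_expect (fun G => Finset.sum_nonneg fun i _ => by split_ifs <;> simp) ?_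
        rintro G ⟨i, hi, hG⟩
        refine le_trans (by simp [hG]) (Finset.single_le_sum (f := fun i =>
          if E i G then (1 : ℝ) else 0) (fun i _ => by split_ifs <;> simp) hi)
    _ = ∑ i ∈ s, prob (E i) := by
        rw [Finset.expect_sum_comm]
        refine Finset.sum_congr rfl fun i _ => ?_
        unfold prob
        congr!
    _ ≤ s.card * x := by
        rw [← nsmul_eq_mul]
        exact Finset.sum_le_card_nsmul s _ x h

lemma prob_or_le (E F : (Fin S → Fin N → ℤˣ) → Prop) :
    prob (fun G => E G ∨ F G) ≤ prob E + prob F := by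
  classical
  unfold prob
  rw [← Finset.expect_add_distrib]
  refine Finset.expect_le_expect fun G _ => ?_
  by_cases h₁ : E G <;> by_cases h₂ : F G <;> simp [h₁, h₂]

lemma cosh_pow_le (t : ℝ) {n : ℕ} {V : ℝ} (hn : (n : ℝ) ≤ V) :
    Real.cosh t ^ n ≤ Real.exp (V * t ^ 2 / 2) := by
  refine (pow_le_pow_left₀ (Real.cosh_pos t).le (Real.cosh_le_exp_half_sq t) n).trans ?_
  rw [← Real.exp_nat_mul, mul_div_assoc]
  exact Real.exp_le_exp.2 (mul_le_mul_of_nonneg_right hn (by positivity))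

lemma prob_le_walk {T : Finset (Fin S × ℕ)} (hne : T.Nonempty) {a b : ℕ}
    (hT : ∀ p ∈ T, b + p.2 ≤ N) {x V : ℝ} (hx : 0 ≤ x) (hV : 0 < V) (hab : ((b - a : ℕ) : ℝ) ≤ V) :
    prob (N := N) (fun G => x ≤ walk G T a b) ≤ Real.exp (-(x ^ 2 / (2 * V))) := by
  calc _ ≤ 𝔼 G : Fin S → Fin N → ℤˣ,
        Real.exp (-(x / V * x)) * Real.exp (x / V * walk G T a b) := by
        refine prob_le_expect (fun G => by positivity) fun G hG => ?_
        rw [← Real.exp_add]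
        refine Real.one_le_exp ?_
        have := mul_le_mul_of_nonneg_left hG (div_nonneg hx hV.le)
        linarith
    _ ≤ Real.exp (-(x / V * x)) * Real.exp (V * (x / V) ^ 2 / 2) := by
        rw [← Finset.mul_expect, expect_exp_walk hne hT]
        exact mul_le_mul_of_nonneg_left (cosh_pow_le _ hab) (Real.exp_pos _).le
    _ = _ := by
        rw [← Real.exp_add]
        congr 1
        field_simp
        ring

lemma prob_walk_le_neg {T : Finset (Fin S × ℕ)} (hne : T.Nonempty) {a b : ℕ}
    (hT : ∀ p ∈ T, b + p.2 ≤ N) {x V : ℝ} (hx : 0 ≤ x) (hV : 0 < V) (hab : ((b - a : ℕ) : ℝ) ≤ V) :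
    prob (N := N) (fun G => walk G T a b ≤ -x) ≤ Real.exp (-(x ^ 2 / (2 * V))) := by
  calc _ ≤ 𝔼 G : Fin S → Fin N → ℤˣ,
        Real.exp (-(x / V * x)) * Real.exp (-(x / V) * walk G T a b) := by
        refine prob_le_expect (fun G => by positivity) fun G hG => ?_
        rw [← Real.exp_add]
        refine Real.one_le_exp ?_
        have := mul_le_mul_of_nonneg_left hG (div_nonneg hx hV.le)
        linarith
    _ ≤ Real.exp (-(x / V * x)) * Real.exp (V * (x / V) ^ 2 / 2) := by
        rw [← Finset.mul_expect, expect_exp_walk hne hT, Real.cosh_neg]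
        exact mul_le_mul_of_nonneg_left (cosh_pow_le _ hab) (Real.exp_pos _).le
    _ = _ := by
        rw [← Real.exp_add]
        congr 1
        field_simp
        ring

/-- Hoeffding's inequality for walks along translates. -/
lemma prob_abs_walk_le {T : Finset (Fin S × ℕ)} (hne : T.Nonempty) {a b : ℕ}
    (hT : ∀ p ∈ T, b + p.2 ≤ N) {x V : ℝ} (hx : 0 ≤ x) (hV : 0 < V) (hab : ((b - a : ℕ) : ℝ) ≤ V) :
    prob (N := N) (fun G => x ≤ |walk G T a b|) ≤ 2 * Real.exp (-(x ^ 2 / (2 * V))) := by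
  have h := (prob_or_le (fun G : Fin S → Fin N → ℤˣ => x ≤ walk G T a b) _).trans
    (add_le_add (prob_le_walk hne hT hx hV hab) (prob_walk_le_neg hne hT hx hV hab))
  rw [← two_mul] at h
  refine (prob_mono fun G hG => ?_).trans h
  rcases le_abs'.1 hG with h | h
  exacts [Or.inr h, Or.inl h]

/-- Events about the first `N` entries have at most their uniform probability under the law of
the infinite family. -/
lemma randomFamily_truncation_le (E : (Fin S → Fin N → ℤˣ) → Prop) :
    randomFamily S {G | E (truncation G N)} ≤ ENNReal.ofReal (prob E) := by
  classical
  have hsub : {G : Fin S × ℕ → ℤˣ | E (truncation G N)} ⊆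
      ⋃ c ∈ Finset.univ.filter E, {G | truncation G N = c} := by
    intro G hG
    simpa using hG
  refine (measure_mono hsub).trans ((measure_biUnion_finset_le _ _).trans ?_)
  simp only [randomFamily_cylinder, Finset.sum_const, nsmul_eq_mul]
  have hprob : prob E = ((Finset.univ.filter E).card : ℝ) * (2⁻¹) ^ (N * S) := by
    unfold prob
    rw [Fintype.expect_eq_sum_div_card, Finset.sum_boole, div_eq_mul_inv]
    congr
    simp [pow_mul]
  rw [hprob, ENNReal.ofReal_mul (by positivity), ENNReal.ofReal_natCast,
    ENNReal.ofReal_pow (by positivity), ENNReal.ofReal_inv_of_pos (by positivity)]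
  simp

/-! ### Correlation sums as walks -/

lemma le_crossCorrelation {k M : ℕ} (hk : 0 < k) {d : Fin k → ℕ} {s : Fin k → Fin S}
    (G : Fin S → Fin N → ℤˣ) (h : IsAdmissible N S k M d s) :
    (correlationSum G M d s).natAbs ≤ crossCorrelation k G := by
  have hd : ∀ i, d i < N := fun i => by have := h.1; have := h.2.2.1 i; omega
  have hM : M < N + 1 := by have := h.2.2.1 ⟨0, hk⟩; omega
  classical
  exact Finset.le_sup (f := fun t : Fin (N + 1) × (Fin k → Fin N) × (Fin k → Fin S) =>
    (correlationSum G t.1 (fun i => (t.2.1 i : ℕ)) t.2.2).natAbs)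
    (b := (⟨M, hM⟩, fun i => ⟨d i, hd i⟩, s)) (Finset.mem_filter.2 ⟨Finset.mem_univ _, h⟩)

lemma crossCorrelation_le {k c : ℕ} (G : Fin S → Fin N → ℤˣ)
    (h : ∀ M (d : Fin k → ℕ) s, IsAdmissible N S k M d s → (correlationSum G M d s).natAbs ≤ c) :
    crossCorrelation k G ≤ c := by
  classical
  exact Finset.sup_le fun t ht => h _ _ _ (Finset.mem_filter.1 ht).2

/-- A tuple that is admissible for length `N` is admissible for every greater length. -/
lemma monotone_crossCorrelation {k : ℕ} (hk : 0 < k) (G : Fin S × ℕ → ℤˣ) :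
    Monotone fun N => crossCorrelation k (truncation G N) := by
  intro N N' hN
  refine crossCorrelation_le _ fun M d s h => ?_
  have h' : IsAdmissible N' S k M d s :=
    ⟨h.1, h.2.1, fun i => (h.2.2.1 i).trans hN, h.2.2.2⟩
  convert le_crossCorrelation hk (truncation G N') h' using 2
  refine Finset.sum_congr rfl fun n hn => Finset.prod_congr rfl fun i _ => ?_
  have h₁ := h.2.2.1 i
  have h₂ := Finset.mem_range.1 hn
  simp [signEntry, truncation, show n + d i < N by omega, show n + d i < N' by omega]

lemma cast_correlationSum {k : ℕ} (G : Fin S → Fin N → ℤˣ) (M : ℕ) (d : Fin k → ℕ)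
    (s : Fin k → Fin S) :
    (correlationSum G M d s : ℝ) = ∑ n ∈ Finset.range M, ∏ i, sgn G (s i, n + d i) := by
  simp [correlationSum, sgn]

/-- The positions of a tuple of order `m + 1` relative to its first shift: the pairs of a sequence
and a shift, the first shift being `0` and the others being given by `u`. -/
def positions {m : ℕ} (u : Fin m → ℕ) (s : Fin (m + 1) → Fin S) : Finset (Fin S × ℕ) :=
  Finset.univ.image fun i => (s i, (Fin.cons 0 u : Fin (m + 1) → ℕ) i)

lemma positions_nonempty {m : ℕ} (u : Fin m → ℕ) (s : Fin (m + 1) → Fin S) :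
    (positions u s).Nonempty := Finset.univ_nonempty.image _

lemma exists_correlationSum_eq_walk {m M : ℕ} {d : Fin (m + 1) → ℕ} {s : Fin (m + 1) → Fin S}
    (h : IsAdmissible N S (m + 1) M d s) :
    ∃ u : Fin m → Fin N, (∀ p ∈ positions (fun i => (u i : ℕ)) s, d 0 + M + p.2 ≤ N) ∧
      ∀ G : Fin S → Fin N → ℤˣ,
        (correlationSum G M d s : ℝ) =
          walk G (positions (fun i => (u i : ℕ)) s) (d 0) (d 0 + M) := by
  have h0 : ∀ i, d 0 ≤ d i := fun i => h.2.1 (Fin.zero_le i)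
  refine ⟨fun i => ⟨d i.succ - d 0, by have := h.1; have := h.2.2.1 i.succ; omega⟩, ?_, ?_⟩ <;>
    have hcons : ∀ i, (Fin.cons 0 (fun i : Fin m => d i.succ - d 0) : Fin (m + 1) → ℕ) i =
      d i - d 0 := fun i => by refine Fin.cases ?_ (fun i => ?_) i <;> simp
  · intro p hp
    obtain ⟨i, -, rfl⟩ := Finset.mem_image.1 hp
    have := h.2.2.1 i
    have := h0 i
    simp only [hcons]
    omega
  · intro G
    rw [cast_correlationSum, walk, Finset.sum_Ico_eq_sum_range, Nat.add_sub_cancel_left]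
    refine Finset.sum_congr rfl fun n _ => ?_
    rw [monomial, positions, Finset.prod_image]
    · refine Finset.prod_congr rfl fun i _ => ?_
      have := h0 i
      simp only [hcons]
      congr 2
      omega
    · intro i _ j _ hij
      simp only [hcons, Prod.mk.injEq] at hij
      by_contra hne
      have := h.2.2.2 i j hne hij.1
      have := h0 i
      have := h0 j
      omega

/-- Walks along positions in a single sequence are correlation sums. -/
lemma abs_walk_le_crossCorrelation {k M : ℕ} (hk : 0 < k) (hM : 1 ≤ M) (s : Fin S) {B : Finset ℕ}
    (hB : B.card = k) (hN : ∀ b ∈ B, M + b ≤ N) (G : Fin S → Fin N → ℤˣ) :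
    |walk G (B.image fun b => (s, b)) 0 M| ≤ crossCorrelation k G := by
  have hadm : IsAdmissible N S k M (B.orderEmbOfFin hB) fun _ => s :=
    ⟨hM, (B.orderEmbOfFin hB).monotone, fun i => hN _ (B.orderEmbOfFin_mem hB i),
      fun i j hij _ he => hij ((B.orderEmbOfFin hB).injective he)⟩
  have hsum : walk G (B.image fun b => (s, b)) 0 M =
      (correlationSum G M (B.orderEmbOfFin hB) fun _ => s : ℝ) := by
    rw [cast_correlationSum, walk, ← Finset.range_eq_Ico]
    refine Finset.sum_congr rfl fun n _ => ?_
    rw [monomial, Finset.prod_image (by intro a _ b _ h; simpa using h)]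
    conv_lhs => rw [← Finset.image_orderEmbOfFin_univ B hB]
    rw [Finset.prod_image (by intro a _ b _ h; exact (B.orderEmbOfFin hB).injective h)]
  rw [hsum, ← Int.cast_abs, Int.abs_eq_natAbs]
  exact_mod_cast le_crossCorrelation hk G hadm

/-! ### The upper tail of the cross-correlation measure -/

lemma walk_add_walk (G : Fin S → Fin N → ℤˣ) (T : Finset (Fin S × ℕ)) {a b c : ℕ} (hab : a ≤ b)
    (hbc : b ≤ c) : walk G T a b + walk G T b c = walk G T a c :=
  Finset.sum_Ico_consecutive _ hab hbc

lemma prob_and_abs_walk_le {T : Finset (Fin S × ℕ)} (hne : T.Nonempty) {a b : ℕ} {x V : ℝ}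
    (hx : 0 ≤ x) (hV : 0 < V) (hab : ((b - a : ℕ) : ℝ) ≤ V) :
    prob (N := N) (fun G => (∀ p ∈ T, b + p.2 ≤ N) ∧ x ≤ |walk G T a b|) ≤
      2 * Real.exp (-(x ^ 2 / (2 * V))) := by
  by_cases hT : ∀ p ∈ T, b + p.2 ≤ N
  · exact (prob_mono fun G hG => hG.2).trans (prob_abs_walk_le hne hT hx hV hab)
  · refine le_trans (le_of_eq ?_) (by positivity : (0 : ℝ) ≤ _)
    exact Finset.expect_eq_zero fun G _ => if_neg fun h => hT h.1

/-- A union bound for the cross-correlation measure. Relative to its first shift, a tuple of order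
`m + 1` is one of at most `N ^ m * S ^ (m + 1)` sets of positions; every interval of summation
consists of an interval between multiples of `L` and two corrections of length at most `L`. -/
lemma prob_lt_crossCorrelation_le (m : ℕ) {L : ℕ} (hL : 0 < L) (hN : 0 < N) {x y : ℝ}
    (hx : 0 ≤ x) (hy : 0 ≤ y) :
    prob (N := N) (S := S) (fun G => x + 2 * y < crossCorrelation (m + 1) G) ≤
      (N : ℝ) ^ m * S ^ (m + 1) * (((N / L : ℕ) + 1) ^ 2 * (2 * Real.exp (-(x ^ 2 / (2 * N)))) +
        (N + 1) ^ 2 * (2 * Real.exp (-(y ^ 2 / (2 * L))))) := by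
  set T : (Fin m → Fin N) × (Fin (m + 1) → Fin S) → Finset (Fin S × ℕ) :=
    fun v => positions (fun i => (v.1 i : ℕ)) v.2 with hTdef
  have hTne : ∀ v, (T v).Nonempty := fun v => positions_nonempty _ _
  set E : (Fin m → Fin N) × (Fin (m + 1) → Fin S) → (Fin S → Fin N → ℤˣ) → Prop := fun v G =>
    (∃ i ∈ Finset.range (N / L + 1) ×ˢ Finset.range (N / L + 1),
        (∀ p ∈ T v, i.2 * L + p.2 ≤ N) ∧ x ≤ |walk G (T v) (i.1 * L) (i.2 * L)|) ∨
      ∃ i ∈ (Finset.range (N + 1) ×ˢ Finset.range (N + 1)).filter fun i => i.2 - i.1 ≤ L,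
        (∀ p ∈ T v, i.2 + p.2 ≤ N) ∧ y ≤ |walk G (T v) i.1 i.2| with hE
  have hsub : ∀ G : Fin S → Fin N → ℤˣ, x + 2 * y < crossCorrelation (m + 1) G →
      ∃ v ∈ (Finset.univ : Finset ((Fin m → Fin N) × (Fin (m + 1) → Fin S))), E v G := by
    intro G hG
    by_contra hcon
    push Not at hcon
    refine hG.not_ge ?_
    refine le_trans (Nat.cast_le.2 (crossCorrelation_le (c := ⌊x + 2 * y⌋₊) G ?_))
      (Nat.floor_le (by positivity))
    intro M d s hadm
    refine Nat.le_floor ?_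
    obtain ⟨u, hfit, hwalk⟩ := exists_correlationSum_eq_walk hadm
    rw [Nat.cast_natAbs, Int.cast_abs, hwalk G]
    have hv := hcon (u, s) (Finset.mem_univ _)
    simp only [hE, not_or, not_exists, not_and, not_le] at hv
    obtain ⟨hv₁, hv₂⟩ := hv
    change ∀ p ∈ T (u, s), d 0 + M + p.2 ≤ N at hfit
    change |walk G (T (u, s)) (d 0) (d 0 + M)| ≤ _
    obtain ⟨p, hp⟩ := hTne (u, s)
    generalize T (u, s) = T₀ at *
    generalize d 0 = a at *
    have hab : a ≤ a + M := Nat.le_add_right _ _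
    generalize a + M = b at *
    have hbN : b ≤ N := by have := hfit p hp; omega
    have ha' : a / L * L ≤ a := Nat.div_mul_le_self a L
    have hb' : b / L * L ≤ b := Nat.div_mul_le_self b L
    have hab' : a / L * L ≤ b / L * L := Nat.mul_le_mul_right L (Nat.div_le_div_right hab)
    have haL : a - a / L * L ≤ L := by
      have h := Nat.div_add_mod' a L; have := Nat.mod_lt a hL; omega
    have hbL : b - b / L * L ≤ L := by
      have h := Nat.div_add_mod' b L; have := Nat.mod_lt b hL; omega
    have h₁ := hv₁ (a / L, b / L) (by
      have := Nat.div_le_div_right (c := L) hbN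
      have := Nat.div_le_div_right (c := L) (hab.trans hbN)
      simp only [Finset.mem_product, Finset.mem_range]
      omega) fun p hp => by have := hfit p hp; simp only; omega
    have h₂ := hv₂ (a / L * L, a) (by
      simp only [Finset.mem_filter, Finset.mem_product, Finset.mem_range]
      omega) fun p hp => by have := hfit p hp; simp only; omega
    have h₃ := hv₂ (b / L * L, b) (by
      simp only [Finset.mem_filter, Finset.mem_product, Finset.mem_range]
      omega) fun p hp => by have := hfit p hp; simp only; omega
    simp only at h₁ h₂ h₃
    have e₁ := walk_add_walk G T₀ ha' hab
    have e₂ := walk_add_walk G T₀ hab' hb'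
    rw [abs_lt] at h₁ h₂ h₃
    rw [abs_le]
    constructor <;> linarith
  refine (prob_mono hsub).trans ((prob_exists_le _ _ _ fun v _ => (prob_or_le _ _).trans
    (add_le_add (prob_exists_le _ _ _ fun i hi => prob_and_abs_walk_le (hTne v) hx
      (V := N) (by positivity) ?_) (prob_exists_le _ _ _ fun i hi =>
        prob_and_abs_walk_le (hTne v) hy (V := L) (by positivity) ?_))).trans ?_)
  · have hi₂ := (Finset.mem_product.1 hi).2
    exact Nat.cast_le.2 ((Nat.sub_le _ _).trans ((Nat.mul_le_mul_right L
      (Nat.lt_succ_iff.1 (Finset.mem_range.1 hi₂))).trans (Nat.div_mul_le_self N L)))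
  · exact Nat.cast_le.2 (Finset.mem_filter.1 hi).2
  · simp only [Finset.card_univ, Fintype.card_prod, Fintype.card_fun, Fintype.card_fin,
      Finset.card_product, Finset.card_range]
    push_cast
    refine mul_le_mul_of_nonneg_left (add_le_add (le_of_eq (by ring)) ?_) (by positivity)
    refine mul_le_mul_of_nonneg_right ?_ (by positivity)
    refine (Nat.cast_le.2 (Finset.card_filter_le _ _)).trans (le_of_eq ?_)
    simp [sq]

/-! ### The second moment method -/

/-- Chebyshev's inequality for a sum of nearly normalized and nearly uncorrelated variables. -/
lemma prob_forall_eq_zero_le {ι : Type*} {U : Finset ι} (hU : U.Nonempty)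
    (Y : ι → (Fin S → Fin N → ℤˣ) → ℝ) {κ ξ v : ℝ} (hξ : 0 ≤ ξ)
    (hmean : ∀ A ∈ U, 1 - κ ≤ 𝔼 G, Y A G) (hdiag : ∀ A ∈ U, 𝔼 G, Y A G * Y A G ≤ v)
    (hoff : ∀ A ∈ U, ∀ B ∈ U, A ≠ B → 𝔼 G, Y A G * Y B G ≤ 1 + ξ) :
    prob (fun G => ∀ A ∈ U, Y A G = 0) ≤ v / U.card + ξ + 2 * κ := by
  classical
  set u : ℝ := (U.card : ℝ) with hu
  have hu0 : 0 < u := Nat.cast_pos.2 hU.card_pos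
  obtain ⟨A₀, hA₀⟩ := hU
  have hv : 0 ≤ v :=
    (Finset.expect_nonneg fun G _ => mul_self_nonneg (Y A₀ G)).trans (hdiag A₀ hA₀)
  have hlin : u * (1 - κ) ≤ 𝔼 G, ∑ A ∈ U, Y A G := by
    rw [Finset.expect_sum_comm, hu, ← nsmul_eq_mul]
    exact Finset.card_nsmul_le_sum U _ _ hmean
  have hsq : 𝔼 G, (∑ A ∈ U, Y A G) * (∑ B ∈ U, Y B G) ≤ u * (v + u * (1 + ξ)) := by
    simp only [Finset.sum_mul_sum]
    rw [Finset.expect_sum_comm, hu, ← nsmul_eq_mul]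
    refine Finset.sum_le_card_nsmul U _ _ fun A hA => ?_
    rw [Finset.expect_sum_comm]
    calc ∑ B ∈ U, 𝔼 G, Y A G * Y B G ≤ ∑ B ∈ U, ((if A = B then v else 0) + (1 + ξ)) := by
          refine Finset.sum_le_sum fun B hB => ?_
          split_ifs with h
          · subst h
            linarith [hdiag A hA]
          · linarith [hoff A hA B hB h]
      _ = v + U.card * (1 + ξ) := by
          rw [Finset.sum_add_distrib, Finset.sum_ite_eq, if_pos hA, Finset.sum_const, nsmul_eq_mul]
  calc prob (fun G => ∀ A ∈ U, Y A G = 0)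
      ≤ 𝔼 G, ((∑ A ∈ U, Y A G) / u - 1) ^ 2 := by
        refine prob_le_expect (fun G => sq_nonneg _) fun G hG => ?_
        rw [Finset.sum_eq_zero hG]
        norm_num
    _ = (𝔼 G, (∑ A ∈ U, Y A G) * (∑ B ∈ U, Y B G)) * (1 / u ^ 2) -
          (𝔼 G, ∑ A ∈ U, Y A G) * (2 / u) + 1 := by
        rw [Finset.expect_mul, Finset.expect_mul, ← Finset.expect_sub_distrib,
          ← Fintype.expect_one (ι := Fin S → Fin N → ℤˣ) (M := ℝ), ← Finset.expect_add_distrib]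
        refine Finset.expect_congr rfl fun G _ => ?_
        rw [Fintype.expect_one]
        field_simp
        ring
    _ ≤ u * (v + u * (1 + ξ)) * (1 / u ^ 2) - u * (1 - κ) * (2 / u) + 1 := by
        gcongr
    _ = v / u + ξ + 2 * κ := by
        field_simp
        ring

lemma exp_le_cosh (t : ℝ) : Real.exp (t ^ 2 / 2 - t ^ 4 / 4) ≤ Real.cosh t := by
  have h₁ : 1 + t ^ 2 / 2 ≤ Real.cosh t := by
    have h := Real.cosh_sq (t / 2)
    have h' := Real.cosh_two_mul (t / 2)
    have h'' : (t / 2) ^ 2 ≤ Real.sinh (t / 2) ^ 2 := by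
      rw [sq_le_sq, Real.abs_sinh]
      exact Real.self_le_sinh_iff.2 (abs_nonneg _)
    rw [mul_div_cancel₀ t two_ne_zero] at h'
    nlinarith
  refine le_trans ?_ h₁
  -- `exp (-x / (1 + x)) ≥ 1 / (1 + x)` with `x = t ^ 2 / 2`, and `x / (1 + x) ≥ x - x ^ 2`.
  set x := t ^ 2 / 2 with hx
  have hx0 : 0 ≤ x := by positivity
  have h₂ : t ^ 2 / 2 - t ^ 4 / 4 ≤ x / (1 + x) := by
    rw [le_div_iff₀ (by positivity), show t ^ 2 / 2 - t ^ 4 / 4 = x - x ^ 2 by rw [hx]; ring]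
    nlinarith [pow_nonneg hx0 3]
  refine (Real.exp_le_exp.2 h₂).trans ?_
  have h₃ := Real.add_one_le_exp (-(x / (1 + x)))
  have h₄ : -(x / (1 + x)) + 1 = (1 + x)⁻¹ := by field_simp; ring
  rw [h₄, Real.exp_neg] at h₃
  exact (inv_le_inv₀ (by positivity) (Real.exp_pos _)).1 h₃

lemma inv_cosh_pow_le (t : ℝ) (M : ℕ) :
    (Real.cosh t ^ M)⁻¹ ≤ Real.exp (M * (t ^ 4 / 4 - t ^ 2 / 2)) := by
  rw [← neg_sub, mul_neg, Real.exp_neg, Real.exp_nat_mul]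
  exact inv_anti₀ (by positivity) (pow_le_pow_left₀ (Real.exp_pos _).le (exp_le_cosh t) M)

/-- The exponential weight of a walk of length `M`, normalized to mean `1` and restricted to the
range where the walk is within the factor `1 ± δ` of `M * t`, its typical size under this
weight. -/
noncomputable def tiltedWeight (M : ℕ) (t δ c : ℝ) : ℝ :=
  if (1 - δ) * (M * t) ≤ c ∧ c ≤ (1 + δ) * (M * t) then Real.exp (t * c) / Real.cosh t ^ M else 0

lemma tiltedWeight_nonneg (M : ℕ) (t δ c : ℝ) : 0 ≤ tiltedWeight M t δ c := by
  unfold tiltedWeight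
  split_ifs <;> positivity

lemma tiltedWeight_le (M : ℕ) (t δ c : ℝ) :
    tiltedWeight M t δ c ≤ Real.exp (t * c) / Real.cosh t ^ M := by
  unfold tiltedWeight
  split_ifs
  exacts [le_rfl, by positivity]

lemma tiltedWeight_le_exp {t δ : ℝ} (ht : 0 ≤ t) (M : ℕ) (c : ℝ) :
    tiltedWeight M t δ c ≤ Real.exp ((1 + δ) * (M * t ^ 2)) / Real.cosh t ^ M := by
  unfold tiltedWeight
  split_ifs with h
  · refine div_le_div_of_nonneg_right (Real.exp_le_exp.2 ?_) (by positivity)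
    calc t * c ≤ t * ((1 + δ) * (M * t)) := mul_le_mul_of_nonneg_left h.2 ht
      _ = _ := by ring
  · positivity

lemma le_expect_tiltedWeight {T : Finset (Fin S × ℕ)} (hne : T.Nonempty) {M : ℕ}
    (hT : ∀ p ∈ T, M + p.2 ≤ N) {t δ : ℝ} (ht : 0 ≤ t) (hδ : 0 ≤ δ) :
    1 - 2 * Real.exp (M * (t ^ 4 / 4 - δ ^ 2 * t ^ 2 / 2)) ≤
      𝔼 G : Fin S → Fin N → ℤˣ, tiltedWeight M t δ (walk G T 0 M) := by
  set W := Real.cosh t ^ M with hW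
  have hW0 : 0 < W := pow_pos (Real.cosh_pos t) M
  have hδt : 0 ≤ δ * t := mul_nonneg hδ ht
  have hbound : ∀ σ : ℝ, σ ^ 2 = 1 →
      Real.cosh ((1 + σ * δ) * t) ^ M * (Real.exp (-(σ * δ * (1 + σ * δ) * (M * t ^ 2))) * W⁻¹) ≤
        Real.exp (M * (t ^ 4 / 4 - δ ^ 2 * t ^ 2 / 2)) := by
    intro σ hσ
    calc _ ≤ Real.exp (M * ((1 + σ * δ) * t) ^ 2 / 2) *
          (Real.exp (-(σ * δ * (1 + σ * δ) * (M * t ^ 2))) *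
            Real.exp (M * (t ^ 4 / 4 - t ^ 2 / 2))) := by
          gcongr
          exacts [cosh_pow_le _ le_rfl, inv_cosh_pow_le t M]
      _ = _ := by
          rw [← Real.exp_add, ← Real.exp_add]
          congr 1
          linear_combination (-(M : ℝ) * δ ^ 2 * t ^ 2 / 2) * hσ
  calc _ ≤ 1 - Real.cosh ((1 + (-1) * δ) * t) ^ M *
          (Real.exp (-((-1) * δ * (1 + (-1) * δ) * (M * t ^ 2))) * W⁻¹) -
        Real.cosh ((1 + 1 * δ) * t) ^ M *
          (Real.exp (-(1 * δ * (1 + 1 * δ) * (M * t ^ 2))) * W⁻¹) := by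
        linarith [hbound (-1) (by norm_num), hbound 1 (by norm_num)]
    _ = 𝔼 G : Fin S → Fin N → ℤˣ, (Real.exp (t * walk G T 0 M) * W⁻¹ -
        Real.exp ((1 + (-1) * δ) * t * walk G T 0 M) *
          (Real.exp (-((-1) * δ * (1 + (-1) * δ) * (M * t ^ 2))) * W⁻¹) -
        Real.exp ((1 + 1 * δ) * t * walk G T 0 M) *
          (Real.exp (-(1 * δ * (1 + 1 * δ) * (M * t ^ 2))) * W⁻¹)) := by
        rw [Finset.expect_sub_distrib, Finset.expect_sub_distrib, ← Finset.expect_mul,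
          ← Finset.expect_mul, ← Finset.expect_mul, expect_exp_walk hne hT, expect_exp_walk hne hT,
          expect_exp_walk hne hT, Nat.sub_zero, ← hW, mul_inv_cancel₀ hW0.ne']
    _ ≤ _ := by
        refine Finset.expect_le_expect fun G _ => ?_
        set c := walk G T 0 M
        have hmerge : ∀ a b : ℝ, Real.exp a * (Real.exp b * W⁻¹) = Real.exp (a + b) * W⁻¹ :=
          fun a b => by rw [Real.exp_add, mul_assoc]
        rw [hmerge, hmerge]
        have hpos₁ : 0 ≤ Real.exp ((1 + (-1) * δ) * t * c +
          -((-1) * δ * (1 + (-1) * δ) * (M * t ^ 2))) * W⁻¹ := by positivity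
        have hpos₂ : 0 ≤ Real.exp ((1 + 1 * δ) * t * c +
          -(1 * δ * (1 + 1 * δ) * (M * t ^ 2))) * W⁻¹ := by positivity
        unfold tiltedWeight
        split_ifs with h
        · rw [div_eq_mul_inv]
          linarith
        · rw [not_and_or, not_le, not_le] at h
          rcases h with h | h
          · have : Real.exp (t * c) * W⁻¹ ≤ Real.exp ((1 + (-1) * δ) * t * c +
                -((-1) * δ * (1 + (-1) * δ) * (M * t ^ 2))) * W⁻¹ := by
              refine mul_le_mul_of_nonneg_right (Real.exp_le_exp.2 ?_) (by positivity)
              nlinarith [mul_le_mul_of_nonneg_left h.le hδt]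
            linarith
          · have : Real.exp (t * c) * W⁻¹ ≤ Real.exp ((1 + 1 * δ) * t * c +
                -(1 * δ * (1 + 1 * δ) * (M * t ^ 2))) * W⁻¹ := by
              refine mul_le_mul_of_nonneg_right (Real.exp_le_exp.2 ?_) (by positivity)
              nlinarith [mul_le_mul_of_nonneg_left h.le hδt]
            linarith

lemma expect_tiltedWeight_sq_le {T : Finset (Fin S × ℕ)} (hne : T.Nonempty) {M : ℕ}
    (hT : ∀ p ∈ T, M + p.2 ≤ N) {t δ : ℝ} (ht : 0 ≤ t) :
    𝔼 G : Fin S → Fin N → ℤˣ,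
      tiltedWeight M t δ (walk G T 0 M) * tiltedWeight M t δ (walk G T 0 M) ≤
        Real.exp (M * (t ^ 4 / 4 + (1 / 2 + δ) * t ^ 2)) := by
  have hW0 : 0 < Real.cosh t ^ M := pow_pos (Real.cosh_pos t) M
  calc _ ≤ 𝔼 G : Fin S → Fin N → ℤˣ, Real.exp ((1 + δ) * (M * t ^ 2)) / Real.cosh t ^ M *
        (Real.exp (t * walk G T 0 M) * (Real.cosh t ^ M)⁻¹) :=
        Finset.expect_le_expect fun G _ => mul_le_mul (tiltedWeight_le_exp ht M _)
          (tiltedWeight_le M t δ _) (tiltedWeight_nonneg _ _ _ _) (by positivity)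
    _ = Real.exp ((1 + δ) * (M * t ^ 2)) * (Real.cosh t ^ M)⁻¹ := by
        rw [← Finset.mul_expect, ← Finset.expect_mul, expect_exp_walk hne hT, Nat.sub_zero,
          mul_inv_cancel₀ hW0.ne', mul_one, div_eq_mul_inv]
    _ ≤ Real.exp ((1 + δ) * (M * t ^ 2)) * Real.exp (M * (t ^ 4 / 4 - t ^ 2 / 2)) :=
        mul_le_mul_of_nonneg_left (inv_cosh_pow_le t M) (Real.exp_pos _).le
    _ = _ := by
        rw [← Real.exp_add]
        congr 1
        ring

/-- The tilted weights of two walks whose translates end in the same position are nearly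
uncorrelated: the exponential martingale governs them unless the walk along the symmetric
difference exceeds `η`, and then the restriction in the weights is used. -/
lemma expect_tiltedWeight_mul_le {A B : Finset (Fin S × ℕ)} (hAB : A ≠ B) {q : Fin S × ℕ} {M : ℕ}
    (hA : ∀ p ∈ A, p.2 < q.2) (hB : ∀ p ∈ B, p.2 < q.2) (hM : M + q.2 ≤ N) {t δ η V : ℝ}
    (ht : 0 ≤ t) (hη : 0 ≤ η) (hV : 0 < V) (hMV : (M : ℝ) ≤ V) :
    𝔼 G : Fin S → Fin N → ℤˣ, tiltedWeight M t δ (walk G (insert q A) 0 M) *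
      tiltedWeight M t δ (walk G (insert q B) 0 M) ≤
        Real.exp (t ^ 2 * η) +
          Real.exp (2 * (1 + δ) * (M * t ^ 2)) * Real.exp (-(η ^ 2 / (2 * V))) := by
  classical
  set W := Real.cosh t ^ M with hW
  have hW1 : 1 ≤ W := one_le_pow₀ (Real.one_le_cosh t)
  have hW0 : 0 < W := zero_lt_one.trans_le hW1
  set D : (Fin S → Fin N → ℤˣ) → ℝ := fun G => ∏ n ∈ Finset.range M,
    Real.exp (t * (sgn G (q.1, n + q.2) * (monomial G A n + monomial G B n))) /
      Real.cosh (t * (monomial G A n + monomial G B n)) with hD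
  have hD0 : ∀ G, 0 ≤ D G := fun G => Finset.prod_nonneg fun n _ =>
    div_nonneg (Real.exp_pos _).le (Real.cosh_pos _).le
  have hsymm : ∀ p ∈ symmDiff A B, M + p.2 ≤ N := by
    intro p hp
    have : p.2 < q.2 := (Finset.mem_symmDiff.1 hp).elim (fun h => hA p h.1) fun h => hB p h.1
    omega
  have htail := prob_le_walk (N := N) (Finset.symmDiff_nonempty.2 hAB) (a := 0) hsymm hη hV
    (by simpa using hMV)
  calc _ ≤ 𝔼 G : Fin S → Fin N → ℤˣ, (D G * Real.exp (t ^ 2 * η) +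
        Real.exp (2 * (1 + δ) * (M * t ^ 2)) *
          if η ≤ walk G (symmDiff A B) 0 M then (1 : ℝ) else 0) := by
        refine Finset.expect_le_expect fun G _ => ?_
        split_ifs with h
        · refine le_trans ?_ (le_add_of_nonneg_left (mul_nonneg (hD0 G) (Real.exp_pos _).le))
          refine (mul_le_mul (tiltedWeight_le_exp ht M _) (tiltedWeight_le_exp ht M _)
            (tiltedWeight_nonneg _ _ _ _) (by positivity)).trans ?_
          rw [div_mul_div_comm, ← Real.exp_add, mul_one]
          refine (div_le_self (Real.exp_pos _).le (one_le_mul_of_one_le_of_one_le hW1 hW1)).trans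
            (Real.exp_le_exp.2 (le_of_eq ?_))
          ring
        · rw [mul_zero, add_zero]
          have := exp_walk_add_walk_le hA hB hM ht hη G (not_le.1 h).le
          refine (mul_le_mul (tiltedWeight_le M t δ _) (tiltedWeight_le M t δ _)
            (tiltedWeight_nonneg _ _ _ _) (by positivity)).trans ?_
          rw [div_mul_div_comm, ← Real.exp_add, ← mul_add, ← hW, div_le_iff₀ (by positivity)]
          refine this.trans (le_of_eq ?_)
          rw [← hW]
          ring
    _ = Real.exp (t ^ 2 * η) + Real.exp (2 * (1 + δ) * (M * t ^ 2)) *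
          prob (N := N) fun G => η ≤ walk G (symmDiff A B) 0 M := by
        rw [Finset.expect_add_distrib, ← Finset.expect_mul, ← Finset.mul_expect,
          expect_prod_exp_div_cosh hA hB hM, one_mul]
        unfold prob
        congr!
    _ ≤ _ := by
        gcongr

/-- The second moment method applied to the tilted weights of the walks along the sets
`A ∪ {K}` with `A ⊆ {0, …, K - 1}` of size `m`, all within one sequence. -/
lemma prob_crossCorrelation_lt_le (s : Fin S) {m K M : ℕ} (hM1 : 1 ≤ M) (hmK : m ≤ K)
    (hM : M + K ≤ N) {t δ η V : ℝ} (ht : 0 ≤ t) (hδ : 0 ≤ δ) (hη : 0 ≤ η) (hV : 0 < V)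
    (hMV : (M : ℝ) ≤ V) :
    prob (N := N) (S := S) (fun G => crossCorrelation (m + 1) G < (1 - δ) * (M * t)) ≤
      Real.exp (M * (t ^ 4 / 4 + (1 / 2 + δ) * t ^ 2)) / K.choose m +
        (Real.exp (t ^ 2 * η) - 1 +
          Real.exp (2 * (1 + δ) * (M * t ^ 2)) * Real.exp (-(η ^ 2 / (2 * V)))) +
        2 * (2 * Real.exp (M * (t ^ 4 / 4 - δ ^ 2 * t ^ 2 / 2))) := by
  classical
  set U := Finset.powersetCard m (Finset.range K) with hU
  have hcard : U.card = K.choose m := by rw [hU, Finset.card_powersetCard, Finset.card_range]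
  have hUne : U.Nonempty := Finset.powersetCard_nonempty.2 (by simpa using hmK)
  set T : Finset ℕ → Finset (Fin S × ℕ) := fun A => A.image fun a => (s, a) with hT
  have hinj : Function.Injective fun a : ℕ => (s, a) := fun a b h => by simpa using h
  have hlt : ∀ A ∈ U, ∀ p ∈ T A, p.2 < ((s, K) : Fin S × ℕ).2 := by
    intro A hA p hp
    obtain ⟨a, ha, rfl⟩ := Finset.mem_image.1 hp
    exact Finset.mem_range.1 ((Finset.mem_powersetCard.1 hA).1 ha)
  have hfit : ∀ A ∈ U, ∀ p ∈ insert (s, K) (T A), M + p.2 ≤ N := by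
    intro A hA p hp
    rcases Finset.mem_insert.1 hp with rfl | hp
    · exact hM
    · have := hlt A hA p hp
      simp only at this
      omega
  have hmain := prob_forall_eq_zero_le (N := N) hUne
    (fun A G => tiltedWeight M t δ (walk G (insert (s, K) (T A)) 0 M))
    (ξ := Real.exp (t ^ 2 * η) - 1 +
          Real.exp (2 * (1 + δ) * (M * t ^ 2)) * Real.exp (-(η ^ 2 / (2 * V))))
    (by
      have := Real.one_le_exp (mul_nonneg (sq_nonneg t) hη)
      have : 0 ≤ Real.exp (2 * (1 + δ) * (M * t ^ 2)) * Real.exp (-(η ^ 2 / (2 * V))) := by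
        positivity
      linarith)
    (fun A hA => le_expect_tiltedWeight (Finset.insert_nonempty _ _) (hfit A hA) ht hδ)
    (fun A hA => expect_tiltedWeight_sq_le (Finset.insert_nonempty _ _) (hfit A hA) ht)
    (fun A hA B hB hAB => (expect_tiltedWeight_mul_le
      (fun h => hAB (Finset.image_injective hinj h)) (hlt A hA) (hlt B hB) hM ht hη hV hMV).trans
      (le_of_eq (by ring)))
  rw [hcard] at hmain
  refine (prob_mono fun G hG A hA => ?_).trans hmain
  refine if_neg fun h => ?_
  have hKA : K ∉ A := fun h => by
    simpa using (Finset.mem_powersetCard.1 hA).1 h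
  have hle := abs_walk_le_crossCorrelation (k := m + 1) (Nat.succ_pos m) hM1 s (B := insert K A)
    (by rw [Finset.card_insert_of_notMem hKA, (Finset.mem_powersetCard.1 hA).2])
    (fun b hb => hfit A hA (s, b) (by
      rw [hT, ← Finset.image_insert (fun a => (s, a))]
      exact Finset.mem_image_of_mem (fun a => (s, a)) hb)) G
  rw [Finset.image_insert] at hle
  exact (h.1.trans ((le_abs_self _).trans hle)).not_gt hG

/-! ### Polynomially small tail probabilities -/

/-- The size `√(2 N log (N ^ m))` of the cross-correlation measure of order `m + 1`. -/
noncomputable def scale (m N : ℕ) : ℝ := Real.sqrt (2 * N * (m * Real.log N))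

lemma scale_nonneg (m N : ℕ) : 0 ≤ scale m N := Real.sqrt_nonneg _

lemma scale_sq (m N : ℕ) : scale m N ^ 2 = 2 * N * (m * Real.log N) :=
  Real.sq_sqrt (by have := Real.log_natCast_nonneg N; positivity)

lemma eventually_mul_rpow_neg_le (C : ℝ) {a c : ℝ} (h : c < a) :
    ∀ᶠ N : ℕ in atTop, C * (N : ℝ) ^ (-a) ≤ (N : ℝ) ^ (-c) := by
  have hlim : Tendsto (fun N : ℕ => C * (N : ℝ) ^ (-(a - c))) atTop (𝓝 (C * 0)) :=
    ((tendsto_rpow_neg_atTop (sub_pos.2 h)).comp tendsto_natCast_atTop_atTop).const_mul C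
  rw [mul_zero] at hlim
  filter_upwards [hlim.eventually_le_const zero_lt_one, eventually_gt_atTop 0] with N hN hN0
  have hN0' : (0 : ℝ) < N := Nat.cast_pos.2 hN0
  calc C * (N : ℝ) ^ (-a) = C * (N : ℝ) ^ (-(a - c)) * (N : ℝ) ^ (-c) := by
        rw [mul_assoc, ← Real.rpow_add hN0']
        congr 2
        ring
    _ ≤ 1 * (N : ℝ) ^ (-c) := mul_le_mul_of_nonneg_right hN (by positivity)
    _ = _ := one_mul _

lemma exp_le_rpow {N : ℕ} (hN : 0 < N) {x a : ℝ} (h : x ≤ a * Real.log N) :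
    Real.exp x ≤ (N : ℝ) ^ a := by
  rw [Real.rpow_def_of_pos (Nat.cast_pos.2 hN), mul_comm]
  exact Real.exp_le_exp.2 h

lemma exists_prob_lt_crossCorrelation_le {m : ℕ} (hm : 1 ≤ m) (S : ℕ) {δ : ℝ} (hδ : 0 < δ) :
    ∃ c : ℝ, 0 < c ∧ ∀ᶠ N : ℕ in atTop,
      prob (N := N) (S := S) (fun G => (1 + δ) * scale m N < crossCorrelation (m + 1) G) ≤
        (N : ℝ) ^ (-c) := by
  set ε := δ / 3 with hε
  have hε0 : 0 < ε := by positivity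
  have hm' : (1 : ℝ) ≤ m := by exact_mod_cast hm
  -- `q` blocks, so many that the corrections at the ends of an interval are negligible
  obtain ⟨q, hq⟩ := exists_nat_ge (2 * (m + 4) / ε ^ 2 + 1 : ℝ)
  have hq1 : (1 : ℝ) ≤ q := le_trans (by have : 0 ≤ 2 * (m + 4) / ε ^ 2 := by positivity
                                         linarith) hq
  have hq0 : 0 < q := by exact_mod_cast hq1
  have hqε : m + 4 ≤ ε ^ 2 * q / 2 := by
    have : 2 * (m + 4) / ε ^ 2 ≤ (q : ℝ) := by linarith
    rw [div_le_iff₀ (by positivity)] at this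
    linarith
  set c := min ε 1 with hc
  have hc0 : 0 < c := lt_min hε0 one_pos
  refine ⟨c, hc0, ?_⟩
  filter_upwards [eventually_mul_rpow_neg_le
    ((S : ℝ) ^ (m + 1) * ((q + 1) ^ 2 * 2) + (S : ℝ) ^ (m + 1) * 8)
    (show c < 2 * c by linarith), eventually_ge_atTop q, eventually_gt_atTop 1] with N hN hNq hN1
  refine le_trans ?_ hN
  have hN0 : 0 < N := by omega
  have hN0' : (0 : ℝ) < N := Nat.cast_pos.2 hN0
  have hN1' : (1 : ℝ) ≤ N := by exact_mod_cast hN0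
  have hlog : 0 ≤ Real.log N := Real.log_natCast_nonneg N
  set L := N / q + 1 with hL
  have hLpos : 0 < L := Nat.succ_pos _
  have hLq : (L : ℝ) * q ≤ 2 * N := by
    have : L * q ≤ 2 * N := by
      have := Nat.div_mul_le_self N q
      rw [hL, add_mul]
      omega
    exact_mod_cast this
  have hNL : N / L ≤ q := by
    refine Nat.div_le_of_le_mul ?_
    have := Nat.lt_mul_div_succ N hq0
    rw [hL, mul_comm]
    omega
  have hx := exp_le_rpow hN0 (x := -(((1 + ε) * scale m N) ^ 2 / (2 * N)))
    (a := -((1 + ε) ^ 2 * m)) (by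
      rw [mul_pow, scale_sq]
      refine le_of_eq ?_
      field_simp)
  have hy := exp_le_rpow hN0 (x := -((ε * scale m N) ^ 2 / (2 * L)))
    (a := -(m + 4)) (by
      rw [mul_pow, scale_sq, neg_mul, neg_le_neg_iff, le_div_iff₀ (by positivity)]
      have h₁ : (m + 4) * (2 * L) ≤ ε ^ 2 * (2 * N * m) :=
        calc (m + 4) * (2 * (L : ℝ)) ≤ ε ^ 2 * q / 2 * (2 * L) :=
              mul_le_mul_of_nonneg_right hqε (by positivity)
          _ = ε ^ 2 * (L * q) := by ring
          _ ≤ ε ^ 2 * (2 * N * m) := mul_le_mul_of_nonneg_left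
              (hLq.trans (le_mul_of_one_le_right (by positivity) hm')) (by positivity)
      calc _ = (m + 4) * (2 * L) * Real.log N := by ring
        _ ≤ ε ^ 2 * (2 * N * m) * Real.log N := mul_le_mul_of_nonneg_right h₁ hlog
        _ = _ := by ring)
  have hb := prob_lt_crossCorrelation_le (S := S) m hLpos hN0
    (x := (1 + ε) * scale m N) (y := ε * scale m N)
    (mul_nonneg (by positivity) (scale_nonneg _ _)) (mul_nonneg hε0.le (scale_nonneg _ _))
  rw [show (1 + ε) * scale m N + 2 * (ε * scale m N) = (1 + δ) * scale m N by rw [hε]; ring] at hb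
  refine hb.trans ?_
  have h₁ : (N : ℝ) ^ m * (N : ℝ) ^ (-((1 + ε) ^ 2 * m)) ≤ (N : ℝ) ^ (-(2 * c)) := by
    rw [← Real.rpow_natCast, ← Real.rpow_add hN0']
    refine Real.rpow_le_rpow_of_exponent_le hN1' ?_
    have : c ≤ ε := min_le_left _ _
    nlinarith [mul_nonneg (sq_nonneg ε) (zero_le_one.trans hm')]
  have h₂ : (N : ℝ) ^ m * (N + 1) ^ 2 * (N : ℝ) ^ (-(m + 4) : ℝ) ≤ 4 * (N : ℝ) ^ (-(2 * c)) := by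
    calc (N : ℝ) ^ m * (N + 1) ^ 2 * (N : ℝ) ^ (-(m + 4) : ℝ)
        ≤ (N : ℝ) ^ m * (2 * N) ^ 2 * (N : ℝ) ^ (-(m + 4) : ℝ) := by gcongr; linarith
      _ = 4 * ((N : ℝ) ^ (m : ℝ) * (N : ℝ) ^ (2 : ℝ) * (N : ℝ) ^ (-(m + 4) : ℝ)) := by
          rw [Real.rpow_natCast, Real.rpow_two]; ring
      _ ≤ _ := by
          rw [← Real.rpow_add hN0', ← Real.rpow_add hN0']
          refine mul_le_mul_of_nonneg_left (Real.rpow_le_rpow_of_exponent_le hN1' ?_) (by norm_num)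
          have : c ≤ 1 := min_le_right _ _
          linarith
  have hNL' : ((N / L : ℕ) : ℝ) ≤ q := Nat.cast_le.2 hNL
  calc _ ≤ (N : ℝ) ^ m * S ^ (m + 1) * ((q + 1) ^ 2 * (2 * (N : ℝ) ^ (-((1 + ε) ^ 2 * m))) +
        (N + 1) ^ 2 * (2 * (N : ℝ) ^ (-(m + 4) : ℝ))) := by gcongr
    _ = S ^ (m + 1) * ((q + 1) ^ 2 * 2) * ((N : ℝ) ^ m * (N : ℝ) ^ (-((1 + ε) ^ 2 * m))) +
        S ^ (m + 1) * 2 * ((N : ℝ) ^ m * (N + 1) ^ 2 * (N : ℝ) ^ (-(m + 4) : ℝ)) := by ring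
    _ ≤ S ^ (m + 1) * ((q + 1) ^ 2 * 2) * (N : ℝ) ^ (-(2 * c)) +
        S ^ (m + 1) * 2 * (4 * (N : ℝ) ^ (-(2 * c))) := by gcongr
    _ = _ := by ring

lemma eventually_mul_log_le (C : ℝ) {r : ℝ} (hr : 0 < r) :
    ∀ᶠ N : ℕ in atTop, C * Real.log N ≤ (N : ℝ) ^ r := by
  have h := (((isLittleO_log_rpow_atTop hr).const_mul_left C).bound one_pos).filter_mono
    (tendsto_natCast_atTop_atTop (R := ℝ))
  rw [eventually_map] at h
  filter_upwards [h] with N hN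
  rw [one_mul, Real.norm_of_nonneg (by positivity : (0 : ℝ) ≤ (N : ℝ) ^ r)] at hN
  exact (le_abs_self _).trans hN

/-- The number of sets of shifts is of order `N ^ m`. -/
lemma exists_le_choose_div (m : ℕ) {q : ℕ} (hq : 0 < q) :
    ∃ C : ℝ, 0 < C ∧ ∀ᶠ N : ℕ in atTop, m ≤ N / q ∧ (N : ℝ) ^ m ≤ C * (N / q).choose m := by
  refine ⟨(4 * q) ^ m * m.factorial, by positivity, ?_⟩
  filter_upwards [eventually_ge_atTop (2 * q * (m + 1))] with N hN
  have hK : N < q * (N / q + 1) := Nat.lt_mul_div_succ N hq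
  have h₁ : 2 * (m + 1) ≤ N / q := by
    rw [Nat.le_div_iff_mul_le hq]
    linarith
  refine ⟨by omega, ?_⟩
  have h₂ : N ≤ 4 * q * (N / q + 1 - m) := by
    have : N / q + 1 ≤ 4 * (N / q + 1 - m) := by omega
    calc N ≤ q * (N / q + 1) := hK.le
      _ ≤ q * (4 * (N / q + 1 - m)) := Nat.mul_le_mul_left q this
      _ = _ := by ring
  have h₃ := Nat.pow_le_choose (α := ℝ) m (N / q)
  rw [div_le_iff₀ (by positivity)] at h₃
  calc (N : ℝ) ^ m ≤ ((4 * q * (N / q + 1 - m) : ℕ) : ℝ) ^ m := by gcongr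
    _ = (4 * q) ^ m * ((N / q + 1 - m : ℕ) : ℝ) ^ m := by push_cast; ring
    _ ≤ (4 * q) ^ m * ((N / q).choose m * m.factorial) := by gcongr
    _ = _ := by ring

set_option maxHeartbeats 1000000 in
lemma exists_prob_crossCorrelation_lt_four_mul_le {m : ℕ} (hm : 1 ≤ m) (s : Fin S) {δ : ℝ}
    (hδ : 0 < δ) (hδ4 : δ ≤ 1 / 4) :
    ∃ c : ℝ, 0 < c ∧ ∀ᶠ N : ℕ in atTop,
      prob (N := N) (S := S) (fun G => crossCorrelation (m + 1) G < (1 - 4 * δ) * scale m N) ≤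
        (N : ℝ) ^ (-c) := by
  have hm' : (1 : ℝ) ≤ m := by exact_mod_cast hm
  obtain ⟨q, hq⟩ := exists_nat_ge (1 / δ)
  have hq0' : (0 : ℝ) < q := lt_of_lt_of_le (by positivity) hq
  have hq0 : 0 < q := by exact_mod_cast hq0'
  have hqδ : 1 / (q : ℝ) ≤ δ := by rwa [div_le_comm₀ hq0' hδ]
  obtain ⟨C, hC, hchoose⟩ := exists_le_choose_div m hq0
  -- the tilting parameter `t` below is `1 - 2 * δ` times the critical one, so that `N * t ^ 2`
  -- is `2 * a * log N`
  set a : ℝ := (1 - 2 * δ) ^ 2 * m with ha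
  have ha0 : 0 < a := mul_pos (pow_pos (by linarith) 2) (by linarith)
  set c := min (δ ^ 2 * a / 2) (min (1 / 8) (2 * δ)) / 2 with hc
  have hc0 : 0 < c := by positivity
  have hc₁ : 2 * c ≤ δ ^ 2 * a / 2 := by
    rw [hc, mul_div_cancel₀ _ two_ne_zero]; exact min_le_left _ _
  have hc₂ : 2 * c ≤ 1 / 8 := by
    rw [hc, mul_div_cancel₀ _ two_ne_zero]; exact (min_le_right _ _).trans (min_le_left _ _)
  have hc₃ : 2 * c ≤ 2 * δ := by
    rw [hc, mul_div_cancel₀ _ two_ne_zero]; exact (min_le_right _ _).trans (min_le_right _ _)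
  refine ⟨c, hc0, ?_⟩
  filter_upwards [hchoose, eventually_gt_atTop 1,
    eventually_mul_log_le a (show (0 : ℝ) < 1 / 2 by norm_num),
    eventually_mul_log_le (4 * a) (show (0 : ℝ) < 1 / 8 by norm_num),
    eventually_mul_log_le (2 * (8 * a + 1)) (show (0 : ℝ) < 1 / 2 by norm_num),
    eventually_mul_rpow_neg_le (Real.exp 1 * C + 2 + 4 * Real.exp 1) (show c < 2 * c by linarith)]
    with N hN hN1 hlog₁ hlog₂ hlog₃ hlast
  obtain ⟨hmK, hNm⟩ := hN
  refine le_trans ?_ hlast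
  have hN0 : 0 < N := by omega
  have hN0' : (0 : ℝ) < N := Nat.cast_pos.2 hN0
  have hN1' : (1 : ℝ) ≤ N := by exact_mod_cast hN0
  have hlog : 0 ≤ Real.log N := Real.log_natCast_nonneg N
  set l := Real.log N with hl
  set K := N / q with hK
  have hKN : (K : ℝ) ≤ δ * N := by
    calc (K : ℝ) ≤ N / q := Nat.cast_div_le
      _ = 1 / q * N := by ring
      _ ≤ δ * N := by gcongr
  have hKle : K ≤ N := Nat.div_le_self _ _
  set M := N - K with hM
  have hMcast : (M : ℝ) = N - K := by rw [hM, Nat.cast_sub hKle]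
  have hMN : (M : ℝ) ≤ N := by rw [hMcast]; linarith [Nat.cast_nonneg (α := ℝ) K]
  have hMN' : (1 - δ) * N ≤ M := by rw [hMcast]; linarith
  have hM1 : 1 ≤ M := by
    have : (0 : ℝ) < M := lt_of_lt_of_le (mul_pos (by linarith) hN0') hMN'
    exact_mod_cast this
  set t := (1 - 2 * δ) * scale m N / N with ht
  have ht0 : 0 ≤ t := div_nonneg (mul_nonneg (by linarith) (scale_nonneg _ _)) hN0'.le
  have ht2 : N * t ^ 2 = 2 * a * l := by
    rw [ht, div_pow, mul_pow, scale_sq, ha, ← hl]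
    field_simp
  have ht2' : t ^ 2 = 2 * a * l / N := by rw [← ht2]; field_simp
  have hMt : M * t ^ 2 ≤ 2 * a * l := ht2 ▸ mul_le_mul_of_nonneg_right hMN (sq_nonneg t)
  have hal : 0 ≤ a * l := mul_nonneg ha0.le hlog
  have hδal : δ * (a * l) ≤ 1 / 4 * (a * l) := mul_le_mul_of_nonneg_right hδ4 hal
  have hMt' : a * l ≤ M * t ^ 2 := by
    have h : (1 - δ) * (N * t ^ 2) ≤ M * t ^ 2 := by
      rw [← mul_assoc]; exact mul_le_mul_of_nonneg_right hMN' (sq_nonneg t)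
    rw [ht2] at h
    linarith
  have hMt4 : M * (t ^ 4 / 4) ≤ 1 := by
    have h₁ : (a * l) ^ 2 ≤ (N : ℝ) := by
      calc (a * l) ^ 2 ≤ ((N : ℝ) ^ (1 / 2 : ℝ)) ^ 2 := by gcongr
        _ = (N : ℝ) := by rw [← Real.rpow_natCast, ← Real.rpow_mul hN0'.le]; norm_num
    calc M * (t ^ 4 / 4) = M * t ^ 2 * t ^ 2 / 4 := by ring
      _ ≤ 2 * a * l * (2 * a * l / N) / 4 := by rw [← ht2']; gcongr
      _ = (a * l) ^ 2 / N := by ring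
      _ ≤ 1 := (div_le_one hN0').2 h₁
  -- the overlap of two walks is allowed to be as large as `N ^ (3 / 4)`
  set η : ℝ := (N : ℝ) ^ (3 / 4 : ℝ) with hη
  have hη2 : η ^ 2 / (2 * N) = (N : ℝ) ^ (1 / 2 : ℝ) / 2 := by
    have : η ^ 2 = (N : ℝ) ^ (1 / 2 : ℝ) * N := by
      rw [hη, ← Real.rpow_natCast, ← Real.rpow_mul hN0'.le]
      nth_rw 3 [← Real.rpow_one (N : ℝ)]
      rw [← Real.rpow_add hN0']
      norm_num
    rw [this]
    field_simp
  have hmain := prob_crossCorrelation_lt_le (N := N) s hM1 hmK (by omega : M + K ≤ N) ht0 hδ.le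
    (by positivity : 0 ≤ η) hN0' hMN
  have hthreshold : (1 - 4 * δ) * scale m N ≤ (1 - δ) * (M * t) := by
    calc (1 - 4 * δ) * scale m N ≤ (1 - δ) * ((1 - δ) * (1 - 2 * δ)) * scale m N := by
          refine mul_le_mul_of_nonneg_right ?_ (scale_nonneg _ _)
          linarith [mul_nonneg (sq_nonneg δ) (show 0 ≤ 5 - 2 * δ by linarith)]
      _ = (1 - δ) * ((1 - δ) * N * t) := by
          rw [ht]; field_simp
      _ ≤ (1 - δ) * (M * t) := by
          refine mul_le_mul_of_nonneg_left ?_ (by linarith)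
          exact mul_le_mul_of_nonneg_right hMN' ht0
  refine (prob_mono fun G hG => hG.trans_le hthreshold).trans (hmain.trans ?_)
  have hdiag : Real.exp (M * (t ^ 4 / 4 + (1 / 2 + δ) * t ^ 2)) / K.choose m ≤
      Real.exp 1 * C * (N : ℝ) ^ (-(2 * c)) := by
    have h₁ : Real.exp (M * (t ^ 4 / 4 + (1 / 2 + δ) * t ^ 2)) ≤
        Real.exp 1 * (N : ℝ) ^ ((1 + 2 * δ) * a) := by
      calc _ ≤ Real.exp (1 + (1 + 2 * δ) * a * l) := by
            refine Real.exp_le_exp.2 ?_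
            have := mul_le_mul_of_nonneg_left hMt (show 0 ≤ 1 / 2 + δ by linarith)
            linarith
        _ ≤ _ := by
            rw [Real.exp_add]
            exact mul_le_mul_of_nonneg_left (exp_le_rpow hN0 le_rfl) (Real.exp_pos _).le
    have h₂ : (N : ℝ) ^ ((1 + 2 * δ) * a) ≤ (N : ℝ) ^ (-(2 * c)) * (N : ℝ) ^ m := by
      rw [← Real.rpow_natCast, ← Real.rpow_add hN0']
      refine Real.rpow_le_rpow_of_exponent_le hN1' ?_
      have h₃ : (1 + 2 * δ) * (1 - 2 * δ) ^ 2 ≤ 1 - 2 * δ := by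
        linarith [mul_nonneg (sq_nonneg δ) (show 0 ≤ 1 - 2 * δ by linarith)]
      have h₄ := mul_le_mul_of_nonneg_right h₃ (zero_le_one.trans hm')
      have h₅ : 2 * δ ≤ 2 * δ * m := le_mul_of_one_le_right (by positivity) hm'
      rw [ha]
      linarith
    have hchoose0 : (0 : ℝ) < K.choose m := Nat.cast_pos.2 (Nat.choose_pos hmK)
    rw [div_le_iff₀ hchoose0]
    calc _ ≤ Real.exp 1 * ((N : ℝ) ^ (-(2 * c)) * (C * K.choose m)) := by
          refine h₁.trans (mul_le_mul_of_nonneg_left (h₂.trans ?_) (Real.exp_pos _).le)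
          exact mul_le_mul_of_nonneg_left hNm (by positivity)
      _ = _ := by ring
  have hoverlap : Real.exp (t ^ 2 * η) - 1 ≤ (N : ℝ) ^ (-(2 * c)) := by
    have h₁ : t ^ 2 * η ≤ (N : ℝ) ^ (-(1 / 8) : ℝ) / 2 := by
      calc t ^ 2 * η = 4 * a * l * ((N : ℝ) ^ (3 / 4 : ℝ) * (N : ℝ) ^ (-1 : ℝ)) / 2 := by
            rw [ht2', hη, Real.rpow_neg_one]; ring
        _ ≤ (N : ℝ) ^ (1 / 8 : ℝ) * ((N : ℝ) ^ (3 / 4 : ℝ) * (N : ℝ) ^ (-1 : ℝ)) / 2 := by gcongr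
        _ = _ := by
            rw [← Real.rpow_add hN0', ← Real.rpow_add hN0']
            norm_num
    have h₂ : (N : ℝ) ^ (-(1 / 8) : ℝ) ≤ 1 :=
      Real.rpow_le_one_of_one_le_of_nonpos hN1' (by norm_num)
    have h₃ : 0 ≤ t ^ 2 * η := by positivity
    have h₄ := Real.abs_exp_sub_one_le (x := t ^ 2 * η) (by rw [abs_of_nonneg h₃]; linarith)
    rw [abs_of_nonneg h₃] at h₄
    have h₅ : (N : ℝ) ^ (-(1 / 8) : ℝ) ≤ (N : ℝ) ^ (-(2 * c)) :=
      Real.rpow_le_rpow_of_exponent_le hN1' (by linarith)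
    linarith [le_abs_self (Real.exp (t ^ 2 * η) - 1)]
  have htail : Real.exp (2 * (1 + δ) * (M * t ^ 2)) * Real.exp (-(η ^ 2 / (2 * N))) ≤
      (N : ℝ) ^ (-(2 * c)) := by
    rw [← Real.exp_add, hη2]
    refine (exp_le_rpow hN0 (a := -1) ?_).trans
      (Real.rpow_le_rpow_of_exponent_le hN1' (by linarith))
    rw [← hl]
    have h₁ := mul_le_mul_of_nonneg_left hMt (show 0 ≤ 2 * (1 + δ) by linarith)
    linarith
  have hmean : Real.exp (M * (t ^ 4 / 4 - δ ^ 2 * t ^ 2 / 2)) ≤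
      Real.exp 1 * (N : ℝ) ^ (-(2 * c)) := by
    calc _ ≤ Real.exp (1 + -(2 * c) * l) := by
          refine Real.exp_le_exp.2 ?_
          have h₁ := mul_le_mul_of_nonneg_left hMt' (show 0 ≤ δ ^ 2 / 2 by positivity)
          have h₂ := mul_le_mul_of_nonneg_right hc₁ hlog
          linarith
      _ ≤ _ := by
          rw [Real.exp_add]
          exact mul_le_mul_of_nonneg_left (exp_le_rpow hN0 le_rfl) (Real.exp_pos _).le
  calc _ ≤ Real.exp 1 * C * (N : ℝ) ^ (-(2 * c)) + ((N : ℝ) ^ (-(2 * c)) +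
        (N : ℝ) ^ (-(2 * c))) + 2 * (2 * (Real.exp 1 * (N : ℝ) ^ (-(2 * c)))) := by gcongr
    _ = _ := by ring

lemma exists_prob_crossCorrelation_lt_le {m : ℕ} (hm : 1 ≤ m) (s : Fin S) {δ : ℝ} (hδ : 0 < δ) :
    ∃ c : ℝ, 0 < c ∧ ∀ᶠ N : ℕ in atTop,
      prob (N := N) (S := S) (fun G => crossCorrelation (m + 1) G < (1 - δ) * scale m N) ≤
        (N : ℝ) ^ (-c) := by
  obtain ⟨c, hc, h⟩ := exists_prob_crossCorrelation_lt_four_mul_le hm s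
    (δ := min (δ / 4) (1 / 4)) (by positivity) (min_le_right _ _)
  refine ⟨c, hc, h.mono fun N hN => le_trans (prob_mono fun G hG => hG.trans_le ?_) hN⟩
  refine mul_le_mul_of_nonneg_right ?_ (scale_nonneg _ _)
  linarith [min_le_left (δ / 4) (1 / 4)]

/-! ### Almost sure convergence -/

/-- Borel–Cantelli along the powers `j ^ r`: a polynomial bound `N ^ (-c)` becomes summable once
`r * c > 1`. -/
lemma ae_eventually_not_truncation {E : ∀ N : ℕ, (Fin S → Fin N → ℤˣ) → Prop} {c : ℝ}
    (hE : ∀ᶠ N : ℕ in atTop, prob (E N) ≤ (N : ℝ) ^ (-c)) {r : ℕ} (hr0 : r ≠ 0) (hr : 1 < r * c) :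
    ∀ᵐ G ∂(randomFamily S), ∀ᶠ j : ℕ in atTop, ¬E (j ^ r) (truncation G (j ^ r)) := by
  obtain ⟨J, hJ⟩ := eventually_atTop.1 ((tendsto_pow_atTop (α := ℕ) hr0).eventually hE)
  have hsum : Summable fun j : ℕ => ((j + J : ℕ) : ℝ) ^ (-(r * c)) :=
    (summable_nat_add_iff (f := fun j : ℕ => (j : ℝ) ^ (-(r * c))) J).2
      (Real.summable_nat_rpow.2 (by linarith))
  have hle : ∀ j : ℕ, randomFamily S {G | E ((j + J) ^ r) (truncation G ((j + J) ^ r))} ≤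
      ENNReal.ofReal (((j + J : ℕ) : ℝ) ^ (-(r * c))) := by
    intro j
    refine (randomFamily_truncation_le _).trans (ENNReal.ofReal_le_ofReal
      ((hJ (j + J) (Nat.le_add_left J j)).trans (le_of_eq ?_)))
    rw [Nat.cast_pow, ← Real.rpow_natCast_mul (Nat.cast_nonneg _), mul_neg]
  have hfin : ∑' j : ℕ, randomFamily S {G | E ((j + J) ^ r) (truncation G ((j + J) ^ r))} ≠ ⊤ :=
    ne_top_of_le_ne_top hsum.tsum_ofReal_ne_top (ENNReal.tsum_le_tsum hle)
  filter_upwards [ae_eventually_notMem hfin] with G hG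
  obtain ⟨I, hI⟩ := eventually_atTop.1 hG
  refine eventually_atTop.2 ⟨I + J, fun j hj => ?_⟩
  have := hI (j - J) (by omega)
  rwa [Nat.sub_add_cancel (by omega)] at this

lemma scale_mono (m : ℕ) : Monotone (scale m) := by
  intro a b hab
  refine Real.sqrt_le_sqrt ?_
  have h₁ : (a : ℝ) ≤ b := Nat.cast_le.2 hab
  have h₂ : Real.log a ≤ Real.log b := by
    rcases Nat.eq_zero_or_pos a with rfl | ha
    · simpa using Real.log_natCast_nonneg b
    · exact Real.log_le_log (Nat.cast_pos.2 ha) h₁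
  have := Real.log_natCast_nonneg a
  gcongr

lemma scale_pos {m N : ℕ} (hm : 0 < m) (hN : 1 < N) : 0 < scale m N := by
  have := Real.log_pos (Nat.one_lt_cast.2 hN : (1 : ℝ) < N)
  exact Real.sqrt_pos.2 (by positivity)

/-- Consecutive terms of `scale m (j ^ r)` have ratio tending to `1`. -/
lemma eventually_scale_succ_pow_le (m r : ℕ) {δ : ℝ} (hδ : 0 < δ) :
    ∀ᶠ j : ℕ in atTop, scale m ((j + 1) ^ r) ≤ (1 + δ) * scale m (j ^ r) := by
  have hlim : Tendsto (fun j : ℕ => (1 + 1 / (j : ℝ)) ^ (r + 1)) atTop (𝓝 ((1 + 0) ^ (r + 1))) :=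
    (tendsto_one_div_atTop_nhds_zero_nat.const_add 1).pow _
  rw [add_zero, one_pow] at hlim
  filter_upwards [hlim.eventually_le_const (show (1 : ℝ) < (1 + δ) ^ 2 by nlinarith),
    eventually_ge_atTop 3] with j hj hj3
  have hj0 : (0 : ℝ) < j := Nat.cast_pos.2 (by omega)
  have he : Real.exp 1 ≤ j :=
    Real.exp_one_lt_three.le.trans (by exact_mod_cast hj3)
  -- `log x / x` decreases beyond `e`
  have hlog : Real.log (j + 1) ≤ (1 + 1 / (j : ℝ)) * Real.log j := by
    have := Real.log_div_self_antitoneOn (Set.mem_ofPred_eq ▸ he)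
      (Set.mem_ofPred_eq ▸ he.trans (by linarith : (j : ℝ) ≤ j + 1)) (by linarith : (j : ℝ) ≤ j + 1)
    simp only at this
    rw [div_le_div_iff₀ (by linarith) hj0] at this
    rw [one_add_div hj0.ne', div_mul_eq_mul_div, le_div_iff₀ hj0]
    linarith
  have hlogj : 0 ≤ Real.log j := Real.log_natCast_nonneg j
  refine le_of_sq_le_sq ?_ (mul_nonneg (by linarith) (scale_nonneg _ _))
  rw [mul_pow, scale_sq, scale_sq]
  push_cast
  rw [Real.log_pow, Real.log_pow]
  calc 2 * ((j : ℝ) + 1) ^ r * (m * (r * Real.log (j + 1)))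
      ≤ 2 * ((1 + 1 / (j : ℝ)) * j) ^ r * (m * (r * ((1 + 1 / (j : ℝ)) * Real.log j))) := by
        have := Real.log_nonneg (show (1 : ℝ) ≤ j + 1 by linarith)
        have h : (j : ℝ) + 1 ≤ (1 + 1 / (j : ℝ)) * j := by
          rw [add_mul, one_div_mul_cancel hj0.ne', one_mul]
        have h' : 0 ≤ (m : ℝ) * (r * Real.log (j + 1)) := by positivity
        gcongr
    _ = (1 + 1 / (j : ℝ)) ^ (r + 1) * (2 * (j : ℝ) ^ r * (m * (r * Real.log j))) := by
        rw [mul_pow]; ring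
    _ ≤ _ := by gcongr

lemma eventually_exists_pow_le {P : ℕ → Prop} (hP : ∀ᶠ j in atTop, P j) {r : ℕ} (hr : r ≠ 0) :
    ∀ᶠ N : ℕ in atTop, ∃ j, P j ∧ j ^ r ≤ N ∧ N ≤ (j + 1) ^ r := by
  obtain ⟨J, hJ⟩ := eventually_atTop.1 hP
  filter_upwards [eventually_ge_atTop (J ^ r)] with N hN
  set j := Nat.findGreatest (fun j => j ^ r ≤ N) N with hj
  refine ⟨j, hJ j (Nat.le_findGreatest ((Nat.le_self_pow hr J).trans hN) hN),
    Nat.findGreatest_spec (P := fun j => j ^ r ≤ N) ((Nat.le_self_pow hr J).trans hN) hN, ?_⟩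
  by_contra! h
  have := Nat.le_findGreatest (P := fun j => j ^ r ≤ N) ((Nat.le_self_pow hr (j + 1)).trans h.le)
    h.le
  omega

lemma ae_eventually_abs_sub_scale_le {m : ℕ} (hm : 1 ≤ m) (hS : 1 ≤ S) {δ : ℝ} (hδ : 0 < δ)
    (hδ1 : δ ≤ 1) :
    ∀ᵐ G ∂(randomFamily S), ∀ᶠ N : ℕ in atTop,
      |(crossCorrelation (m + 1) (truncation G N) : ℝ) - scale m N| ≤ 3 * δ * scale m N := by
  obtain ⟨c₁, hc₁, h₁⟩ := exists_prob_lt_crossCorrelation_le hm S hδ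
  obtain ⟨c₂, hc₂, h₂⟩ := exists_prob_crossCorrelation_lt_le hm (⟨0, hS⟩ : Fin S) hδ
  obtain ⟨r, hr⟩ := exists_nat_gt (max (1 / c₁) (1 / c₂))
  have hr₁ : 1 < r * c₁ := (div_lt_iff₀ hc₁).1 ((le_max_left _ _).trans_lt hr)
  have hr₂ : 1 < r * c₂ := (div_lt_iff₀ hc₂).1 ((le_max_right _ _).trans_lt hr)
  have hr0 : r ≠ 0 := by
    rintro rfl
    simp only [Nat.cast_zero, zero_mul] at hr₁
    linarith
  filter_upwards [ae_eventually_not_truncation h₁ hr0 hr₁,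
    ae_eventually_not_truncation h₂ hr0 hr₂] with G hG₁ hG₂
  have hmono : Monotone fun N => (crossCorrelation (m + 1) (truncation G N) : ℝ) :=
    fun a b hab => Nat.cast_le.2 (monotone_crossCorrelation (Nat.succ_pos m) G hab)
  have hall := ((tendsto_add_atTop_nat 1).eventually hG₁).and
    (hG₂.and (eventually_scale_succ_pow_le m r hδ))
  filter_upwards [eventually_exists_pow_le hall hr0] with N hN
  obtain ⟨j, ⟨hup, hlow, hratio⟩, hjN, hNj⟩ := hN
  rw [not_lt] at hup hlow
  have e₁ := scale_mono m hjN
  have e₂ := scale_mono m hNj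
  have e₃ := hmono hjN
  have e₄ := hmono hNj
  simp only at e₃ e₄
  set x := (crossCorrelation (m + 1) (truncation G N) : ℝ)
  have hs := scale_nonneg m N
  have hδs : δ * (δ * scale m N) ≤ δ * scale m N :=
    mul_le_of_le_one_left (mul_nonneg hδ.le hs) hδ1
  rw [abs_le]
  constructor
  · -- `(1 - δ) / (1 + δ) ≥ 1 - 3 * δ`
    have h₃ : (1 - δ) * scale m N ≤ (1 + δ) * x :=
      calc (1 - δ) * scale m N ≤ (1 - δ) * ((1 + δ) * scale m (j ^ r)) :=
            mul_le_mul_of_nonneg_left (e₂.trans hratio) (by linarith)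
        _ = (1 + δ) * ((1 - δ) * scale m (j ^ r)) := by ring
        _ ≤ (1 + δ) * x := mul_le_mul_of_nonneg_left (hlow.trans e₃) (by linarith)
    refine le_of_mul_le_mul_left (a := 1 + δ) ?_ (by linarith)
    nlinarith [mul_nonneg hδ.le (mul_nonneg hδ.le hs)]
  · have h₃ : x ≤ (1 + δ) * ((1 + δ) * scale m N) :=
      e₄.trans (hup.trans (mul_le_mul_of_nonneg_left
        (hratio.trans (mul_le_mul_of_nonneg_left e₁ (by linarith))) (by linarith)))
    linarith

lemma ae_tendsto_div_scale {m : ℕ} (hm : 1 ≤ m) (hS : 1 ≤ S) :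
    ∀ᵐ G ∂(randomFamily S), Tendsto
      (fun N : ℕ => (crossCorrelation (m + 1) (truncation G N) : ℝ) / scale m N) atTop (𝓝 1) := by
  have hall := ae_all_iff.2 fun n : ℕ => ae_eventually_abs_sub_scale_le hm hS
    (δ := 1 / ((n : ℝ) + 1)) (by positivity) ((div_le_one (by positivity)).2 (by simp))
  filter_upwards [hall] with G hG
  rw [Metric.tendsto_nhds]
  intro ε hε
  obtain ⟨n, hn⟩ := exists_nat_one_div_lt (show 0 < ε / 3 by positivity)
  filter_upwards [hG n, eventually_gt_atTop 1] with N hN hN1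
  have hs := scale_pos hm hN1
  rw [Real.dist_eq, div_sub_one hs.ne', abs_div, abs_of_pos hs, div_lt_iff₀ hs]
  exact hN.trans_lt (mul_lt_mul_of_pos_right (by linarith) hs)

lemma tendsto_log_choose_div {m : ℕ} (hm : 1 ≤ m) :
    Tendsto (fun N : ℕ => Real.log (N.choose m) / (m * Real.log N)) atTop (𝓝 1) := by
  have hm' : (0 : ℝ) < m := Nat.cast_pos.2 hm
  have hlog : Tendsto (fun N : ℕ => (m : ℝ) * Real.log N) atTop atTop :=
    (Real.tendsto_log_atTop.comp tendsto_natCast_atTop_atTop).const_mul_atTop hm'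
  have hquot : Tendsto (fun N : ℕ => Real.log ((N.choose m : ℝ) / (N ^ m / m.factorial)))
      atTop (𝓝 (Real.log 1)) := by
    refine Tendsto.log ?_ one_ne_zero
    refine (Asymptotics.isEquivalent_iff_tendsto_one ?_).1 (isEquivalent_choose m)
    filter_upwards [eventually_gt_atTop 0] with N hN
    positivity
  have hlim := (((hquot.sub_const (Real.log m.factorial)).div_atTop hlog).add_const 1)
  rw [zero_add] at hlim
  refine hlim.congr' ?_
  filter_upwards [eventually_ge_atTop m, eventually_gt_atTop 1] with N hN hN1
  have hN0 : (0 : ℝ) < N := Nat.cast_pos.2 (by omega)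
  have hc : (0 : ℝ) < N.choose m := Nat.cast_pos.2 (Nat.choose_pos hN)
  have hl : 0 < (m : ℝ) * Real.log N :=
    mul_pos hm' (Real.log_pos (Nat.one_lt_cast.2 hN1))
  rw [Real.log_div hc.ne' (by positivity), Real.log_div (by positivity) (by positivity),
    Real.log_pow, div_add_one hl.ne']
  congr 1
  ring

end SignFamily

theorem theorem4 (S : ℕ) (hS : 1 ≤ S) (k : ℕ) (hk : 2 ≤ k) :
    ∀ᵐ G ∂(randomFamily S),
      Tendsto
        (fun N : ℕ =>
          (crossCorrelation k (truncation G N) : ℝ) /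
            Real.sqrt (2 * (N : ℝ) * Real.log (Nat.choose N (k - 1) : ℝ)))
        atTop (𝓝 1) := by
  obtain ⟨m, rfl⟩ : ∃ m, k = m + 1 := ⟨k - 1, by omega⟩
  have hm : 1 ≤ m := by omega
  rw [Nat.add_sub_cancel]
  filter_upwards [SignFamily.ae_tendsto_div_scale hm hS] with G hG
  have hsqrt := (SignFamily.tendsto_log_choose_div hm).sqrt
  rw [Real.sqrt_one] at hsqrt
  have hlim := hG.div hsqrt one_ne_zero
  rw [div_one] at hlim
  refine hlim.congr' ?_
  filter_upwards [eventually_gt_atTop 1] with N hN1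
  have hlog : 0 < Real.log (N : ℝ) := Real.log_pos (Nat.one_lt_cast.2 hN1)
  have hm' : (0 : ℝ) < m := Nat.cast_pos.2 hm
  have hN0 : (0 : ℝ) < N := Nat.cast_pos.2 (by omega)
  simp only [Pi.div_apply]
  rw [div_div, SignFamily.scale, ← Real.sqrt_mul (by positivity)]
  congr 2
  field_simp
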